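/- **Setting.** Let $\mathcal P$ be a probability distribution on $\mathbb R$ that is symmetric, has variance $1$ and is sub-Gaussian, where a random variable $Z$ (or its distribution) is called sub-Gaussian with parameter $\tau>0$ if $P(|Z|\ge t)\le 2\exp(-t^2/(2\tau^2))$ for all $t>0$, and sub-Gaussian if this holds for some $\tau>0$. For $X\sim\mathcal P$ put $$\alpha_{\mathcal P}=\sup_{k\ge1}\Big(\frac{E X^{2k}}{(2k-1)!!}\Big)^{1/(2k)}.$$ For a real $p_1\times p_2$ matrix $M$ let $\|M\|_F$, $\|M\|$ and $\|M\|_*$ be the Frobenius, spectral and nuclear norm; if $M=\sum_i a_iu_iv_i^\top$ is a singular value decomposition with $a_1\ge a_2\ge\dots\ge0$, let $M_{\max(r)}=\sum_{i\le r}a_iu_iv_i^\top$ and $M_{-\max(r)}=M-M_{\max(r)}$. For $z\in\mathbb R^n$ let $\|z\|_1=\sum_i|z_i|$. Let $\mathcal X:\mathbb R^{p_1\times p_2}\to\mathbb R^n$, $[\mathcal X(M)]_i=(\beta^{(i)})^\top M\gamma^{(i)}$, be a rank-one projection (ROP) design from $\mathcal P$: all entries of the random vectors $\beta^{(i)}\in\mathbb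 R^{p_1}$ and $\gamma^{(i)}\in\mathbb R^{p_2}$, $i=1,\dots,n$, are i.i.d. with law $\mathcal P$. Let $\mathcal X^*(z)=\sum_i z_i\beta^{(i)}(\gamma^{(i)})^\top$. Let $z_1,\dots,z_n$ be i.i.d. sub-Gaussian with parameter $\tau>0$, with the vector $(z_1,\dots,z_n)$ independent of the design. For $A\in\mathbb R^{p_1\times p_2}$ one observes $y=\mathcal X(A)+z$, and an estimator $\hat A$ is any solution of $$\hat A\in\arg\min_M\{\|M\|_*: y-\mathcal X(M)\in\mathcal Z_G\},$$ $$\mathcal Z_G=\Big\{w\in\mathbb R^n:\tfrac{\|w\|_1}{n}\le6\tau\Big\}\cap\Big\{w\in\mathbb R^n:\|\mathcal X^*(w)\|\le6\alpha_{\mathcal P}^2\tau\big(\sqrt{6n(p_1+p_2)}+2\sqrt{\log n}\,(p_1+p_2)\big)\Big\}.$$ **Theorem 3.1.** There are constants $C,W_1,W_2,\delta>0$ depending only on $\mathcal P$ such that for all positive integers $p_1,p_2,n,r$ with $n\ge Cr(p_1+p_2)$, all $\tau>0$, and all design and noise as above, the following holds on an event of probability at least $1-2/n-5e^{-\delta(p_1+p_2)}$: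 for every matrix $A\in\mathbb R^{p_1\times p_2}$ the minimization problem for $y=\mathcal X(A)+z$ has a solution, and every solution $\hat A$ satisfies $$\|\hat A-A\|_F^2\le W_1\tau^2\min\Big(\frac{r\log n\,(p_1+p_2)^2}{n^2}+\frac{r(p_1+p_2)}{n},\,1\Big)+W_2\frac{\|A_{-\max(r)}\|_*^2}{r}.$$ -/

import Mathlib

open MeasureTheory ProbabilityTheory
open scoped Matrix

namespace ROP

noncomputable section

/-- A distribution on the real line is sub-Gaussian with parameter `τ` if
`P(|Z| ≥ t) ≤ 2 exp(-t² / (2τ²))` for all `t > 0`. No centering is required. -/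
def IsSubGaussian (ν : Measure ℝ) (τ : ℝ) : Prop :=
  ∀ t : ℝ, 0 < t → ν.real {x | t ≤ |x|} ≤ 2 * Real.exp (-t ^ 2 / (2 * τ ^ 2))

/-- A distribution on the real line is symmetric if `-Z` has the same law as `Z`. -/
def IsSymmetric (P : Measure ℝ) : Prop :=
  P.map (fun x => -x) = P

/-- `α_P = sup_{k ≥ 1} (E X^{2k} / (2k-1)!!)^{1/(2k)}` for `X ∼ P`. For a sub-Gaussian `P` all
moments are finite and the supremum is over a bounded set, so it is a genuine supremum. -/
def alpha (P : Measure ℝ) : ℝ :=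
  ⨆ k : ℕ+, ((∫ x, x ^ (2 * (k : ℕ)) ∂P) / (Nat.doubleFactorial (2 * (k : ℕ) - 1) : ℝ)) ^
    ((1 : ℝ) / (2 * (k : ℕ)))

variable {p₁ p₂ n : ℕ}

/-- The squared Frobenius norm of a matrix. -/
def frobSq (M : Matrix (Fin p₁) (Fin p₂) ℝ) : ℝ :=
  ∑ i, ∑ j, M i j ^ 2

/-- The spectral norm `sup_{‖x‖₂ ≤ 1} ‖M x‖₂`, as operator norm between Euclidean spaces. -/
def specNorm (M : Matrix (Fin p₁) (Fin p₂) ℝ) : ℝ :=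
  ‖(Matrix.toEuclideanLin M).toContinuousLinearMap‖

/-- The nuclear norm: the sum of the singular values. (All singular values with index at least
the dimension `p₂` of the domain vanish.) -/
def nuclearNorm (M : Matrix (Fin p₁) (Fin p₂) ℝ) : ℝ :=
  ∑ i ∈ Finset.range p₂, (Matrix.toEuclideanLin M).singularValues i

/-- Right singular vectors of `M`: an orthonormal basis of eigenvectors of `MᵀM`, ordered so that
the eigenvalues, that is the squared singular values, decrease. -/
def rightSingularBasis (M : Matrix (Fin p₁) (Fin p₂) ℝ) :
    OrthonormalBasis (Fin p₂) ℝ (EuclideanSpace ℝ (Fin p₂)) :=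
  (Matrix.toEuclideanLin M).isSymmetric_adjoint_comp_self.eigenvectorBasis
    (by simp [finrank_euclideanSpace])

/-- `M_{max(r)} = ∑_{i ≤ r} aᵢ uᵢ vᵢᵀ`, the part of the singular value decomposition
`M = ∑ᵢ aᵢ uᵢ vᵢᵀ` that belongs to the `r` largest singular values; here `aᵢ uᵢ = M vᵢ`. -/
def maxPart (r : ℕ) (M : Matrix (Fin p₁) (Fin p₂) ℝ) : Matrix (Fin p₁) (Fin p₂) ℝ :=
  ∑ i ∈ Finset.univ.filter (fun i : Fin p₂ => (i : ℕ) < r),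
    Matrix.vecMulVec (M *ᵥ ⇑(rightSingularBasis M i)) ⇑(rightSingularBasis M i)

/-- `M_{-max(r)} = M - M_{max(r)}`. -/
def minusMaxPart (r : ℕ) (M : Matrix (Fin p₁) (Fin p₂) ℝ) : Matrix (Fin p₁) (Fin p₂) ℝ :=
  M - maxPart r M

/-- The rank-one projection map `[𝒳(M)]ᵢ = (β⁽ⁱ⁾)ᵀ M γ⁽ⁱ⁾`. -/
def ropMap (β : Fin n → Fin p₁ → ℝ) (γ : Fin n → Fin p₂ → ℝ)
    (M : Matrix (Fin p₁) (Fin p₂) ℝ) : Fin n → ℝ :=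
  fun i => β i ⬝ᵥ (M *ᵥ γ i)

/-- The dual map `𝒳*(z) = ∑ᵢ zᵢ Xᵢ` with `Xᵢ = β⁽ⁱ⁾ (γ⁽ⁱ⁾)ᵀ`. -/
def dual (β : Fin n → Fin p₁ → ℝ) (γ : Fin n → Fin p₂ → ℝ)
    (z : Fin n → ℝ) : Matrix (Fin p₁) (Fin p₂) ℝ :=
  ∑ i, z i • Matrix.vecMulVec (β i) (γ i)

/-- The constraint set `𝒵_G` for the residual. -/
def constraintSet (P : Measure ℝ) (τ : ℝ) (β : Fin n → Fin p₁ → ℝ) (γ : Fin n → Fin p₂ → ℝ) :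
    Set (Fin n → ℝ) :=
  {z | (∑ i, |z i|) / n ≤ 6 * τ} ∩
  {z | specNorm (dual β γ z) ≤ 6 * alpha P ^ 2 * τ *
      (√(6 * n * (p₁ + p₂)) + 2 * √(Real.log n) * (p₁ + p₂))}

/-- `Ahat` is a solution of `argmin_M {‖M‖_* : y - 𝒳(M) ∈ 𝒵_G}`. -/
def IsEstimator (P : Measure ℝ) (τ : ℝ) (β : Fin n → Fin p₁ → ℝ) (γ : Fin n → Fin p₂ → ℝ)
    (y : Fin n → ℝ) (Ahat : Matrix (Fin p₁) (Fin p₂) ℝ) : Prop :=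
  y - ropMap β γ Ahat ∈ constraintSet P τ β γ ∧
  ∀ M : Matrix (Fin p₁) (Fin p₂) ℝ, y - ropMap β γ M ∈ constraintSet P τ β γ →
    nuclearNorm Ahat ≤ nuclearNorm M

/-- The random map `𝒳` is ROP from the distribution `P`: all the entries of all the vectors
`β⁽ⁱ⁾` and `γ⁽ⁱ⁾` are independent with law `P`. -/
structure IsROP {Ω : Type*} [MeasurableSpace Ω] (μ : Measure Ω) (P : Measure ℝ)
    (β : Fin n → Fin p₁ → Ω → ℝ) (γ : Fin n → Fin p₂ → Ω → ℝ) : Prop where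
  law_left : ∀ i j, HasLaw (β i j) P μ
  law_right : ∀ i k, HasLaw (γ i k) P μ
  indep : iIndepFun (Sum.elim (fun a : Fin n × Fin p₁ => β a.1 a.2)
    (fun b : Fin n × Fin p₂ => γ b.1 b.2)) μ

end

end ROP

namespace ROP

section HilbertSchmidt

open ContinuousLinearMap

variable {E F : Type*} [NormedAddCommGroup E] [InnerProductSpace ℝ E] [FiniteDimensional ℝ E]
  [NormedAddCommGroup F] [InnerProductSpace ℝ F] [FiniteDimensional ℝ F]
  {ι : Type*} [Fintype ι]

/-- The Hilbert–Schmidt inner product of two operators between Euclidean spaces. -/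
noncomputable def hs (L K : E →L[ℝ] F) : ℝ :=
  LinearMap.trace ℝ E ((adjoint L ∘L K : E →L[ℝ] E) : E →ₗ[ℝ] E)

lemma hs_eq_sum (b : OrthonormalBasis ι ℝ E) (L K : E →L[ℝ] F) :
    hs L K = ∑ i, inner ℝ (L (b i)) (K (b i)) := by
  rw [hs, LinearMap.trace_eq_sum_inner _ b]
  simp [adjoint_inner_right]

lemma hs_comm (L K : E →L[ℝ] F) : hs L K = hs K L := by
  simp only [hs_eq_sum (stdOrthonormalBasis ℝ E), real_inner_comm]

lemma hs_add_left (L L' K : E →L[ℝ] F) : hs (L + L') K = hs L K + hs L' K := by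
  simp [hs_eq_sum (stdOrthonormalBasis ℝ E), inner_add_left, Finset.sum_add_distrib]

lemma hs_neg_left (L K : E →L[ℝ] F) : hs (-L) K = -hs L K := by
  simp [hs_eq_sum (stdOrthonormalBasis ℝ E)]

lemma hs_add_right (L K K' : E →L[ℝ] F) : hs L (K + K') = hs L K + hs L K' := by
  simp [hs_eq_sum (stdOrthonormalBasis ℝ E), inner_add_right, Finset.sum_add_distrib]

lemma hs_sub_right (L K K' : E →L[ℝ] F) : hs L (K - K') = hs L K - hs L K' := by
  simp [hs_eq_sum (stdOrthonormalBasis ℝ E), inner_sub_right, Finset.sum_sub_distrib]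

lemma hs_self_eq_sum (b : OrthonormalBasis ι ℝ E) (L : E →L[ℝ] F) :
    hs L L = ∑ i, ‖L (b i)‖ ^ 2 := by
  simp [hs_eq_sum b]

lemma hs_adjoint (L K : E →L[ℝ] F) : hs (adjoint L) (adjoint K) = hs L K := by
  have h := LinearMap.trace_comp_comm' (M := F) (N := E) (R := ℝ)
    ((adjoint K : F →L[ℝ] E) : F →ₗ[ℝ] E) (L : E →ₗ[ℝ] F)
  rw [hs_comm L K, hs, hs, adjoint_adjoint]
  exact h

lemma hs_le_sqrt (L K : E →L[ℝ] F) : hs L K ≤ √(hs L L) * √(hs K K) := by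
  set b := stdOrthonormalBasis ℝ E
  rw [hs_self_eq_sum b, hs_self_eq_sum b, hs_eq_sum b]
  refine (Finset.sum_le_sum fun i _ => real_inner_le_norm _ _).trans ?_
  exact Real.sum_mul_le_sqrt_mul_sqrt _ _ _

lemma hs_comp_self_le (L : E →L[ℝ] F) {G : Type*} [NormedAddCommGroup G] [InnerProductSpace ℝ G]
    [FiniteDimensional ℝ G] (K : F →L[ℝ] G) (hK : ‖K‖ ≤ 1) :
    hs (K ∘L L) (K ∘L L) ≤ hs L L := by
  rw [hs_self_eq_sum (stdOrthonormalBasis ℝ E), hs_self_eq_sum (stdOrthonormalBasis ℝ E)]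
  gcongr with i
  simpa using (K.le_opNorm _).trans (mul_le_of_le_one_left (norm_nonneg _) hK)

lemma hs_self_comp_le (L : E →L[ℝ] F) {G : Type*} [NormedAddCommGroup G] [InnerProductSpace ℝ G]
    [FiniteDimensional ℝ G] (K : G →L[ℝ] E) (hK : ‖K‖ ≤ 1) :
    hs (L ∘L K) (L ∘L K) ≤ hs L L := by
  rw [← hs_adjoint (L ∘L K), ← hs_adjoint L L, adjoint_comp]
  exact hs_comp_self_le _ _ (by rwa [LinearIsometryEquiv.norm_map])

lemma hs_le_norm_mul_sum (b : OrthonormalBasis ι ℝ E) (L K : E →L[ℝ] F) :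
    hs L K ≤ ‖L‖ * ∑ i, ‖K (b i)‖ := by
  rw [hs_eq_sum b, Finset.mul_sum]
  gcongr with i
  refine (real_inner_le_norm _ _).trans ?_
  gcongr
  simpa using L.le_opNorm (b i)

/-- An orthonormal basis consisting of right singular vectors of `A`. -/
def IsSingular (A : E →L[ℝ] F) (v : OrthonormalBasis ι ℝ E) : Prop :=
  ∀ i j, i ≠ j → inner ℝ (A (v i)) (A (v j)) = 0

/-- The partial isometry `∑_{i ∈ s} uᵢ vᵢᵀ` with `A vᵢ = aᵢ uᵢ`. -/
noncomputable def polar (A : E →L[ℝ] F) (v : OrthonormalBasis ι ℝ E) (s : Finset ι) : E →L[ℝ] F :=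
  ∑ i ∈ s, (innerSL ℝ (v i)).smulRight (‖A (v i)‖⁻¹ • A (v i))

variable {A : E →L[ℝ] F} {v : OrthonormalBasis ι ℝ E} {s : Finset ι}

omit [FiniteDimensional ℝ E] [FiniteDimensional ℝ F] in
lemma polar_apply_basis [DecidableEq ι] (k : ι) :
    polar A v s (v k) = if k ∈ s then ‖A (v k)‖⁻¹ • A (v k) else 0 := by
  simp [polar, orthonormal_iff_ite.mp v.orthonormal]

omit [FiniteDimensional ℝ E] [FiniteDimensional ℝ F] in
lemma norm_polar_apply_le [DecidableEq ι] (k : ι) : ‖polar A v s (v k)‖ ≤ if k ∈ s then 1 else 0 := by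
  rw [polar_apply_basis]
  split_ifs
  · rw [norm_smul, norm_inv, norm_norm]
    exact inv_mul_le_one
  · simp

lemma hs_polar [DecidableEq ι] (K : E →L[ℝ] F) (hK : ∀ k ∈ s, K (v k) = A (v k)) :
    hs (polar A v s) K = ∑ i ∈ s, ‖A (v i)‖ := by
  rw [hs_eq_sum v]
  simp only [polar_apply_basis]
  rw [← Finset.sum_subset (Finset.subset_univ s)]
  · refine Finset.sum_congr rfl fun i hi => ?_
    rw [if_pos hi, hK i hi, inner_smul_left, real_inner_self_eq_norm_sq]
    by_cases h : ‖A (v i)‖ = 0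
    · simp [h]
    · simp; field_simp
  · intro i _ hi
    simp [hi]

lemma hs_polar_self_le : hs (polar A v s) (polar A v s) ≤ s.card := by
  classical
  rw [hs_self_eq_sum v]
  calc _ ≤ ∑ i, (if i ∈ s then 1 else 0 : ℝ) := by
        gcongr with i
        have := norm_polar_apply_le (A := A) (v := v) (s := s) i
        split_ifs at * <;> nlinarith [norm_nonneg (polar A v s (v i))]
    _ = s.card := by simp

omit [FiniteDimensional ℝ E] [FiniteDimensional ℝ F] in
lemma IsSingular.inner_polar (hA : IsSingular A v) {i j : ι} (hij : i ≠ j) :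
    inner ℝ (polar A v s (v i)) (polar A v s (v j)) = 0 := by
  classical
  rw [polar_apply_basis, polar_apply_basis]
  split_ifs <;> simp [inner_smul_left, inner_smul_right, hA i j hij]

omit [FiniteDimensional ℝ E] [FiniteDimensional ℝ F] in
lemma polar_apply_basis_eq_zero {k : ι} (hk : ¬(k ∈ s ∧ A (v k) ≠ 0)) :
    polar A v s (v k) = 0 := by
  classical
  rw [polar_apply_basis]
  split_ifs with h
  · have : A (v k) = 0 := by tauto
    simp [this]
  · rfl

lemma IsSingular.adjoint_polar_apply (hA : IsSingular A v) {k : ι} (hk : k ∈ s)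
    (hk' : A (v k) ≠ 0) : adjoint (polar A v s) (polar A v s (v k)) = v k := by
  classical
  apply v.repr.injective
  ext j
  rw [v.repr_apply_apply, v.repr_apply_apply, adjoint_inner_right]
  by_cases hjk : j = k
  · subst hjk
    rw [real_inner_self_eq_norm_sq, polar_apply_basis, if_pos hk]
    simp [hk', norm_smul]
  · rw [hA.inner_polar hjk]
    simp [orthonormal_iff_ite.mp v.orthonormal, hjk]

lemma IsSingular.polar_adjoint_polar (hA : IsSingular A v) (x : E) :
    polar A v s (adjoint (polar A v s) (polar A v s x)) = polar A v s x := by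
  have : (polar A v s ∘L adjoint (polar A v s) ∘L polar A v s : E →L[ℝ] F) = polar A v s := by
    apply ContinuousLinearMap.coe_injective
    apply v.toBasis.ext
    intro k
    simp only [OrthonormalBasis.coe_toBasis, ContinuousLinearMap.coe_coe,
      ContinuousLinearMap.comp_apply]
    by_cases hk : k ∈ s ∧ A (v k) ≠ 0
    · rw [hA.adjoint_polar_apply hk.1 hk.2]
    · rw [polar_apply_basis_eq_zero hk, map_zero, map_zero]
  exact DFunLike.congr_fun this x

/-- `U` is a partial isometry. -/
def IsPartialIsometry (U : E →L[ℝ] F) : Prop :=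
  ∀ x, U (adjoint U (U x)) = U x

namespace IsPartialIsometry

variable {U : E →L[ℝ] F}

lemma norm_sq_add (hU : IsPartialIsometry U) (x : E) :
    ‖U x‖ ^ 2 + ‖x - adjoint U (U x)‖ ^ 2 = ‖x‖ ^ 2 := by
  have h1 : inner ℝ x (adjoint U (U x)) = ‖U x‖ ^ 2 := by
    rw [adjoint_inner_right, real_inner_self_eq_norm_sq]
  have h2 : ‖adjoint U (U x)‖ ^ 2 = ‖U x‖ ^ 2 := by
    rw [← real_inner_self_eq_norm_sq, adjoint_inner_right, hU, real_inner_self_eq_norm_sq]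
  rw [norm_sub_sq_real, h1, h2]
  ring

lemma norm_le (hU : IsPartialIsometry U) : ‖U‖ ≤ 1 := by
  refine U.opNorm_le_bound zero_le_one fun x => ?_
  have := hU.norm_sq_add x
  rw [one_mul]
  exact abs_le_of_sq_le_sq' (by nlinarith [sq_nonneg ‖x - adjoint U (U x)‖]) (norm_nonneg _) |>.2

protected lemma adjoint (hU : IsPartialIsometry U) : IsPartialIsometry (adjoint U) := by
  intro x
  rw [adjoint_adjoint]
  refine ext_inner_left ℝ fun y => ?_
  rw [adjoint_inner_right, ← adjoint_inner_left, adjoint_inner_right, hU, ← adjoint_inner_right]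

lemma norm_compl_le (hU : IsPartialIsometry U) : ‖1 - adjoint U ∘L U‖ ≤ 1 := by
  refine opNorm_le_bound _ zero_le_one fun x => ?_
  have := hU.norm_sq_add x
  rw [one_mul]
  exact abs_le_of_sq_le_sq' (by simpa using by nlinarith [sq_nonneg ‖U x‖]) (norm_nonneg _) |>.2

/-- `B` with rows and columns compressed to the complements of the spaces of `U`. -/
noncomputable def compress (U B : E →L[ℝ] F) : E →L[ℝ] F :=
  (1 - U ∘L adjoint U) ∘L B ∘L (1 - adjoint U ∘L U)

lemma compress_apply (B : E →L[ℝ] F) (x : E) :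
    compress U B x = B (x - adjoint U (U x)) - U (adjoint U (B (x - adjoint U (U x)))) := rfl

lemma norm_add_compress_le (hU : IsPartialIsometry U) {B : E →L[ℝ] F} (hB : ‖B‖ ≤ 1) :
    ‖U + compress U B‖ ≤ 1 := by
  refine opNorm_le_bound _ zero_le_one fun x => ?_
  rw [one_mul]
  have hQ := hU.adjoint.norm_compl_le
  rw [adjoint_adjoint] at hQ
  have h0 : inner ℝ (U x) (compress U B x) = 0 := by
    rw [← adjoint_inner_right]
    have : adjoint U (compress U B x) = 0 := by
      have h := hU.adjoint (B (x - adjoint U (U x)))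
      rw [adjoint_adjoint] at h
      rw [compress_apply, map_sub, h, sub_self]
    rw [this, inner_zero_right]
  have h1 : ‖compress U B x‖ ≤ ‖x - adjoint U (U x)‖ := by
    simp only [compress, ContinuousLinearMap.comp_apply]
    refine (le_of_opNorm_le _ hQ _).trans ?_
    rw [one_mul]
    refine (le_of_opNorm_le _ hB _).trans ?_
    simp
  have h2 := hU.norm_sq_add x
  refine abs_le_of_sq_le_sq' ?_ (norm_nonneg _) |>.2
  rw [add_apply, norm_add_sq_real, h0]
  nlinarith [norm_nonneg (compress U B x)]

lemma hs_le_hs_compress_add (hU : IsPartialIsometry U) {B : E →L[ℝ] F} (hB : ‖B‖ ≤ 1)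
    (H : E →L[ℝ] F) :
    hs B H ≤ hs (compress U B) H + 2 * √(hs U U) * √(hs H H) := by
  have hQ := hU.adjoint.norm_compl_le
  rw [adjoint_adjoint] at hQ
  have hdec : B = compress U B + (U ∘L (adjoint U ∘L B) +
      ((1 - U ∘L adjoint U) ∘L B ∘L adjoint U) ∘L U) := by
    ext x
    simp [compress]
  have h1 : hs (U ∘L (adjoint U ∘L B)) H ≤ √(hs U U) * √(hs H H) := by
    refine (hs_le_sqrt _ _).trans ?_
    gcongr
    refine hs_self_comp_le _ _ ((opNorm_comp_le _ _).trans ?_)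
    exact mul_le_one₀ hU.adjoint.norm_le (norm_nonneg _) hB
  have h2 : hs (((1 - U ∘L adjoint U) ∘L B ∘L adjoint U) ∘L U) H ≤ √(hs U U) * √(hs H H) := by
    refine (hs_le_sqrt _ _).trans ?_
    gcongr
    refine hs_comp_self_le _ _ ((opNorm_comp_le _ _).trans ?_)
    refine mul_le_one₀ hQ (norm_nonneg _) ((opNorm_comp_le _ _).trans ?_)
    exact mul_le_one₀ hB (norm_nonneg _) hU.adjoint.norm_le
  calc hs B H = hs (compress U B) H + (hs (U ∘L (adjoint U ∘L B)) H +
        hs (((1 - U ∘L adjoint U) ∘L B ∘L adjoint U) ∘L U) H) := by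
        rw [← hs_add_left, ← hs_add_left, ← hdec]
    _ ≤ _ := by linarith

end IsPartialIsometry

lemma IsSingular.isPartialIsometry_polar (hA : IsSingular A v) :
    IsPartialIsometry (polar A v s) := hA.polar_adjoint_polar

open IsPartialIsometry in
/-- If `A + H` has nuclear norm at most that of `A`, then the nuclear norm of `H` is controlled by
its Frobenius norm and the nuclear norm of the tail of `A`. -/
theorem IsSingular.hs_le_of_nuclear_le [DecidableEq ι] (hA : IsSingular A v) {Ar H : E →L[ℝ] F}
    (hs1 : ∀ k ∈ s, Ar (v k) = A (v k)) (hs2 : ∀ k ∉ s, Ar (v k) = 0) {a : ℝ}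
    (hAH : ∀ B : E →L[ℝ] F, ‖B‖ ≤ 1 → hs B (A + H) ≤ ∑ i, ‖A (v i)‖)
    (ha : ∀ B : E →L[ℝ] F, ‖B‖ ≤ 1 → hs B (A - Ar) ≤ a) {B : E →L[ℝ] F} (hB : ‖B‖ ≤ 1) :
    hs B H ≤ 2 * a + 3 * √s.card * √(hs H H) := by
  have hU := hA.isPartialIsometry_polar (s := s)
  set U := polar A v s with hUdef
  have hUs : √(hs U U) ≤ √s.card := Real.sqrt_le_sqrt hs_polar_self_le
  have hD := hU.norm_add_compress_le hB
  have e1 := hAH _ hD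
  have e2 := ha (-(U + compress U B)) (by rwa [norm_neg])
  have e3 := ha (polar A v sᶜ) hA.isPartialIsometry_polar.norm_le
  rw [hs_polar (s := sᶜ)] at e3
  swap
  · intro k hk
    simp [hs2 k (by simpa using hk)]
  have e4 : hs U Ar = ∑ i ∈ s, ‖A (v i)‖ := hs_polar Ar hs1
  have e5 : hs (compress U B) Ar = 0 := by
    rw [hs_eq_sum v]
    refine Finset.sum_eq_zero fun k _ => ?_
    by_cases hk : k ∈ s ∧ A (v k) ≠ 0
    · have : v k - adjoint U (U (v k)) = 0 := by
        rw [hUdef, hA.adjoint_polar_apply hk.1 hk.2, sub_self]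
      simp [compress_apply, this]
    · have : Ar (v k) = 0 := by
        by_cases h : k ∈ s
        · rw [hs1 k h]; tauto
        · exact hs2 k h
      rw [this, inner_zero_right]
  have e6 := Finset.sum_add_sum_compl s fun i => ‖A (v i)‖
  have e7 := hU.hs_le_hs_compress_add hB H
  have e8 := hs_le_sqrt (-U) H
  rw [hs_neg_left U H, hs_neg_left U (-U), hs_comm U (-U), hs_neg_left, neg_neg] at e8
  rw [hs_neg_left] at e2
  rw [hs_add_right, hs_add_left, hs_add_left] at e1
  rw [hs_sub_right, hs_add_left, hs_add_left] at e2
  have e9 : √(hs U U) * √(hs H H) ≤ √s.card * √(hs H H) := by gcongr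
  nlinarith

end HilbertSchmidt

section MatrixNorms

variable {p₁ p₂ n : ℕ}

/-- The operator between Euclidean spaces given by a matrix. -/
noncomputable def toOp : Matrix (Fin p₁) (Fin p₂) ℝ ≃ₗ[ℝ]
    (EuclideanSpace ℝ (Fin p₂) →L[ℝ] EuclideanSpace ℝ (Fin p₁)) :=
  Matrix.toEuclideanLin.trans LinearMap.toContinuousLinearMap

lemma toOp_apply (M : Matrix (Fin p₁) (Fin p₂) ℝ) (x : EuclideanSpace ℝ (Fin p₂)) :
    toOp M x = WithLp.toLp 2 (M *ᵥ ⇑x) := rfl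

lemma specNorm_eq (M : Matrix (Fin p₁) (Fin p₂) ℝ) : specNorm M = ‖toOp M‖ := rfl

lemma specNorm_nonneg (M : Matrix (Fin p₁) (Fin p₂) ℝ) : 0 ≤ specNorm M := norm_nonneg _

lemma specNorm_sub_le (M N : Matrix (Fin p₁) (Fin p₂) ℝ) :
    specNorm (M - N) ≤ specNorm M + specNorm N := by
  simp only [specNorm_eq, map_sub]
  exact norm_sub_le _ _

/-- The entrywise inner product of two matrices. -/
def frobInner (B M : Matrix (Fin p₁) (Fin p₂) ℝ) : ℝ := ∑ i, ∑ j, B i j * M i j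

lemma hs_toOp (B M : Matrix (Fin p₁) (Fin p₂) ℝ) : hs (toOp B) (toOp M) = frobInner B M := by
  rw [hs_eq_sum (EuclideanSpace.basisFun (Fin p₂) ℝ), frobInner, Finset.sum_comm]
  refine Finset.sum_congr rfl fun j _ => ?_
  simp [toOp_apply, PiLp.inner_apply, mul_comm]

lemma frobSq_eq_hs (M : Matrix (Fin p₁) (Fin p₂) ℝ) : frobSq M = hs (toOp M) (toOp M) := by
  rw [hs_toOp, frobInner, frobSq]
  simp only [sq]

lemma frobSq_nonneg (M : Matrix (Fin p₁) (Fin p₂) ℝ) : 0 ≤ frobSq M := by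
  unfold frobSq; positivity

lemma inner_toOp_rightSingularBasis (M : Matrix (Fin p₁) (Fin p₂) ℝ) (i j : Fin p₂) :
    inner ℝ (toOp M (rightSingularBasis M i)) (toOp M (rightSingularBasis M j)) =
      if i = j then (Matrix.toEuclideanLin M).singularValues j ^ 2 else 0 := by
  have h := (Matrix.toEuclideanLin M).isSymmetric_adjoint_comp_self.apply_eigenvectorBasis
    (by simp [finrank_euclideanSpace]) j
  have h1 : inner ℝ (toOp M (rightSingularBasis M i)) (toOp M (rightSingularBasis M j)) =
      inner ℝ (rightSingularBasis M i) ((LinearMap.adjoint (Matrix.toEuclideanLin M) ∘ₗ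
        Matrix.toEuclideanLin M) (rightSingularBasis M j)) := by
    rw [LinearMap.comp_apply, LinearMap.adjoint_inner_right]
    rfl
  rw [h1]
  unfold rightSingularBasis at *
  rw [h, inner_smul_right, orthonormal_iff_ite.mp (OrthonormalBasis.orthonormal _),
    LinearMap.sq_singularValues_fin _ (by simp [finrank_euclideanSpace])]
  simp

lemma isSingular_rightSingularBasis (M : Matrix (Fin p₁) (Fin p₂) ℝ) :
    IsSingular (toOp M) (rightSingularBasis M) := fun i j hij => by
  rw [inner_toOp_rightSingularBasis, if_neg hij]

lemma nuclearNorm_eq_sum (M : Matrix (Fin p₁) (Fin p₂) ℝ) :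
    nuclearNorm M = ∑ i, ‖toOp M (rightSingularBasis M i)‖ := by
  rw [nuclearNorm, ← Fin.sum_univ_eq_sum_range]
  refine Finset.sum_congr rfl fun i _ => ?_
  have h := inner_toOp_rightSingularBasis M i i
  rw [real_inner_self_eq_norm_sq, if_pos rfl] at h
  exact ((sq_eq_sq₀ (norm_nonneg _) (LinearMap.singularValues_nonneg _ _)).mp h).symm

lemma nuclearNorm_nonneg (M : Matrix (Fin p₁) (Fin p₂) ℝ) : 0 ≤ nuclearNorm M := by
  rw [nuclearNorm_eq_sum]; positivity

lemma hs_le_nuclearNorm {B : EuclideanSpace ℝ (Fin p₂) →L[ℝ] EuclideanSpace ℝ (Fin p₁)}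
    (hB : ‖B‖ ≤ 1) (M : Matrix (Fin p₁) (Fin p₂) ℝ) : hs B (toOp M) ≤ nuclearNorm M := by
  refine (hs_le_norm_mul_sum (rightSingularBasis M) B (toOp M)).trans ?_
  rw [← nuclearNorm_eq_sum]
  exact mul_le_of_le_one_left (nuclearNorm_nonneg M) hB

lemma frobInner_le (B M : Matrix (Fin p₁) (Fin p₂) ℝ) :
    frobInner B M ≤ specNorm B * nuclearNorm M := by
  rw [← hs_toOp, nuclearNorm_eq_sum]
  exact hs_le_norm_mul_sum (rightSingularBasis M) _ _

lemma exists_hs_eq_nuclearNorm (M : Matrix (Fin p₁) (Fin p₂) ℝ) :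
    ∃ B : EuclideanSpace ℝ (Fin p₂) →L[ℝ] EuclideanSpace ℝ (Fin p₁),
      ‖B‖ ≤ 1 ∧ hs B (toOp M) = nuclearNorm M :=
  ⟨polar (toOp M) (rightSingularBasis M) Finset.univ,
    (isSingular_rightSingularBasis M).isPartialIsometry_polar.norm_le, by
      rw [hs_polar _ fun _ _ => rfl, nuclearNorm_eq_sum]⟩

lemma nuclearNorm_le_add_sub (M N : Matrix (Fin p₁) (Fin p₂) ℝ) :
    nuclearNorm M ≤ nuclearNorm N + nuclearNorm (M - N) := by
  obtain ⟨B, hB, hM⟩ := exists_hs_eq_nuclearNorm M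
  rw [← hM]
  have : toOp M = toOp N + toOp (M - N) := by simp
  rw [this, hs_add_right]
  exact add_le_add (hs_le_nuclearNorm hB _) (hs_le_nuclearNorm hB _)

lemma nuclearNorm_le_sqrt (M : Matrix (Fin p₁) (Fin p₂) ℝ) :
    nuclearNorm M ≤ √p₂ * √(frobSq M) := by
  have h := Real.sum_mul_le_sqrt_mul_sqrt Finset.univ (fun _ => 1)
    fun i => ‖toOp M (rightSingularBasis M i)‖
  rw [frobSq_eq_hs, hs_self_eq_sum (rightSingularBasis M), nuclearNorm_eq_sum]
  simpa using h

lemma sqrt_frobSq_le_nuclearNorm (M : Matrix (Fin p₁) (Fin p₂) ℝ) :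
    √(frobSq M) ≤ nuclearNorm M := by
  rw [frobSq_eq_hs, hs_self_eq_sum (rightSingularBasis M), nuclearNorm_eq_sum]
  refine Real.sqrt_le_iff.mpr ⟨by positivity, ?_⟩
  exact Finset.sum_sq_le_sq_sum_of_nonneg fun _ _ => norm_nonneg _

lemma frobSq_neg (M : Matrix (Fin p₁) (Fin p₂) ℝ) : frobSq (-M) = frobSq M := by
  simp [frobSq]

lemma continuous_frobSq : Continuous (frobSq : Matrix (Fin p₁) (Fin p₂) ℝ → ℝ) := by
  unfold frobSq
  fun_prop

lemma continuous_toOp : Continuous (toOp : Matrix (Fin p₁) (Fin p₂) ℝ → _) :=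
  LinearMap.continuous_of_finiteDimensional (toOp (p₁ := p₁) (p₂ := p₂)).toLinearMap

lemma continuous_specNorm : Continuous (specNorm : Matrix (Fin p₁) (Fin p₂) ℝ → ℝ) :=
  continuous_toOp.norm

lemma continuous_nuclearNorm : Continuous (nuclearNorm : Matrix (Fin p₁) (Fin p₂) ℝ → ℝ) := by
  rw [continuous_iff_continuousAt]
  intro M
  have h : Filter.Tendsto (fun N : Matrix (Fin p₁) (Fin p₂) ℝ => √p₂ * √(frobSq (N - M)))
      (nhds M) (nhds 0) := by
    have : Continuous fun N : Matrix (Fin p₁) (Fin p₂) ℝ => √p₂ * √(frobSq (N - M)) :=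
      continuous_const.mul (continuous_frobSq.comp (continuous_id.sub continuous_const)).sqrt
    simpa [frobSq] using this.tendsto M
  refine tendsto_iff_norm_sub_tendsto_zero.mpr (squeeze_zero (fun _ => norm_nonneg _) ?_ h)
  intro N
  rw [Real.norm_eq_abs, abs_sub_le_iff]
  have h1 := nuclearNorm_le_sqrt (N - M)
  have h2 := nuclearNorm_le_sqrt (M - N)
  have h3 := nuclearNorm_le_add_sub M N
  have h4 := nuclearNorm_le_add_sub N M
  rw [← frobSq_neg, neg_sub] at h2
  constructor <;> linarith

lemma toOp_maxPart_apply (r : ℕ) (M : Matrix (Fin p₁) (Fin p₂) ℝ) (k : Fin p₂) :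
    toOp (maxPart r M) (rightSingularBasis M k) =
      if (k : ℕ) < r then toOp M (rightSingularBasis M k) else 0 := by
  have h : ∀ i, (rightSingularBasis M i).ofLp ⬝ᵥ (rightSingularBasis M k).ofLp =
      if i = k then 1 else 0 := fun i => by
    have := orthonormal_iff_ite.mp (rightSingularBasis M).orthonormal k i
    rw [EuclideanSpace.inner_eq_star_dotProduct] at this
    simpa [eq_comm] using this
  rw [toOp_apply, toOp_apply, maxPart, Matrix.sum_mulVec]
  simp only [Matrix.vecMulVec_mulVec, h]
  simp only [apply_ite MulOpposite.op, MulOpposite.op_one, MulOpposite.op_zero, ite_smul, one_smul,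
    zero_smul, Finset.sum_ite_eq', Finset.mem_filter, Finset.mem_univ, true_and]
  split_ifs <;> rfl

theorem nuclearNorm_le_of_nuclearNorm_add_le (r : ℕ) {A H : Matrix (Fin p₁) (Fin p₂) ℝ}
    (h : nuclearNorm (A + H) ≤ nuclearNorm A) :
    nuclearNorm H ≤ 2 * nuclearNorm (minusMaxPart r A) + 3 * √r * √(frobSq H) := by
  obtain ⟨B, hB, hH⟩ := exists_hs_eq_nuclearNorm H
  rw [← hH, frobSq_eq_hs]
  refine ((isSingular_rightSingularBasis A).hs_le_of_nuclear_le
    (s := Finset.univ.filter fun i : Fin p₂ => (i : ℕ) < r)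
    (Ar := toOp (maxPart r A)) ?_ ?_ ?_ (a := nuclearNorm (minusMaxPart r A)) ?_ hB).trans ?_
  · intro k hk
    rw [toOp_maxPart_apply, if_pos (by simpa using hk)]
  · intro k hk
    rw [toOp_maxPart_apply, if_neg (by simpa using hk)]
  · intro B hB
    rw [← nuclearNorm_eq_sum, ← map_add]
    exact (hs_le_nuclearNorm hB _).trans h
  · intro B hB
    rw [← map_sub]
    exact hs_le_nuclearNorm hB _
  · gcongr
    exact_mod_cast Fin.card_filter_val_lt.trans_le (min_le_right _ _)

end MatrixNorms

section Design

variable {p₁ p₂ n : ℕ} (β : Fin n → Fin p₁ → ℝ) (γ : Fin n → Fin p₂ → ℝ)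

lemma frobInner_dual (w : Fin n → ℝ) (M : Matrix (Fin p₁) (Fin p₂) ℝ) :
    frobInner (dual β γ w) M = ∑ i, w i * ropMap β γ M i := by
  simp only [frobInner, dual, ropMap, Matrix.sum_apply, Matrix.smul_apply, Matrix.vecMulVec_apply,
    dotProduct, Matrix.mulVec, Finset.sum_mul, Finset.mul_sum, smul_eq_mul]
  rw [Finset.sum_congr rfl fun i _ => Finset.sum_comm, Finset.sum_comm]
  refine Finset.sum_congr rfl fun i _ => Finset.sum_congr rfl fun j _ =>
    Finset.sum_congr rfl fun k _ => by ring

lemma dual_sub (w w' : Fin n → ℝ) : dual β γ (w - w') = dual β γ w - dual β γ w' := by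
  simp [dual, sub_smul, Finset.sum_sub_distrib]

lemma ropMap_sub (M N : Matrix (Fin p₁) (Fin p₂) ℝ) :
    ropMap β γ (M - N) = ropMap β γ M - ropMap β γ N := by
  ext i
  simp [ropMap, Matrix.sub_mulVec]

lemma continuous_ropMap : Continuous (ropMap β γ) := by
  unfold ropMap dotProduct Matrix.mulVec dotProduct
  fun_prop

lemma continuous_dual : Continuous (dual β γ) := by
  unfold dual
  fun_prop

lemma isClosed_constraintSet (P : Measure ℝ) (τ : ℝ) : IsClosed (constraintSet P τ β γ) := by
  refine IsClosed.inter ?_ ?_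
  · exact isClosed_le (by fun_prop) continuous_const
  · exact isClosed_le (continuous_specNorm.comp (continuous_dual β γ)) continuous_const

/-- The minimization problem has a solution as soon as it is feasible. -/
lemma exists_isEstimator (P : Measure ℝ) (τ : ℝ) (y : Fin n → ℝ)
    {A : Matrix (Fin p₁) (Fin p₂) ℝ} (hA : y - ropMap β γ A ∈ constraintSet P τ β γ) :
    ∃ Ahat, IsEstimator P τ β γ y Ahat := by
  let S : Set (Matrix (Fin p₁) (Fin p₂) ℝ) :=
    {M | y - ropMap β γ M ∈ constraintSet P τ β γ} ∩ {M | nuclearNorm M ≤ nuclearNorm A}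
  have hclosed : IsClosed S :=
    ((isClosed_constraintSet β γ P τ).preimage
      (continuous_const.sub (continuous_ropMap β γ))).inter
      (isClosed_le continuous_nuclearNorm continuous_const)
  have hsub : S ⊆ Set.univ.pi fun _ => Set.univ.pi fun _ =>
      Set.Icc (-nuclearNorm A) (nuclearNorm A) := by
    rintro M ⟨-, hM⟩ i - j -
    rw [Set.mem_Icc, ← abs_le]
    refine (Real.abs_le_sqrt ?_).trans ((sqrt_frobSq_le_nuclearNorm M).trans hM)
    refine (Finset.single_le_sum (f := fun j => M i j ^ 2) (fun _ _ => sq_nonneg _)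
      (Finset.mem_univ j)).trans ?_
    exact Finset.single_le_sum (f := fun i => ∑ j, M i j ^ 2)
      (fun _ _ => Finset.sum_nonneg fun _ _ => sq_nonneg _) (Finset.mem_univ i)
  have hcomp : IsCompact S :=
    (isCompact_univ_pi fun _ => isCompact_univ_pi fun _ => isCompact_Icc).of_isClosed_subset
      hclosed hsub
  obtain ⟨M, hM, hmin⟩ := hcomp.exists_isMinOn ⟨A, hA, le_refl (nuclearNorm A)⟩
    continuous_nuclearNorm.continuousOn
  refine ⟨M, hM.1, fun N hN => ?_⟩
  rcases le_total (nuclearNorm N) (nuclearNorm A) with h | h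
  · exact hmin ⟨hN, h⟩
  · exact le_trans hM.2 h

end Design

section Deterministic

variable {p₁ p₂ n : ℕ} {β : Fin n → Fin p₁ → ℝ} {γ : Fin n → Fin p₂ → ℝ}

/-- The radius of the spectral norm constraint. -/
noncomputable def specRadius (P : Measure ℝ) (τ : ℝ) (p₁ p₂ n : ℕ) : ℝ :=
  6 * alpha P ^ 2 * τ * (√(6 * n * (p₁ + p₂)) + 2 * √(Real.log n) * (p₁ + p₂))

lemma specRadius_sq_le (P : Measure ℝ) (τ : ℝ) (p₁ p₂ n : ℕ) :
    specRadius P τ p₁ p₂ n ^ 2 ≤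
      432 * alpha P ^ 4 * τ ^ 2 * (n * (p₁ + p₂) + Real.log n * (p₁ + p₂) ^ 2) := by
  have h1 := Real.sq_sqrt (show (0 : ℝ) ≤ 6 * n * (p₁ + p₂) by positivity)
  have h2 := Real.sq_sqrt (Real.log_natCast_nonneg n)
  unfold specRadius
  set a := √(6 * (n : ℝ) * (p₁ + p₂))
  set b := √(Real.log n)
  rw [← h2]
  have h3 : (a + 2 * b * (p₁ + p₂)) ^ 2 ≤ 12 * (n * (p₁ + p₂) + b ^ 2 * (p₁ + p₂) ^ 2) := by
    have : 0 ≤ (b * (p₁ + p₂)) ^ 2 := by positivity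
    nlinarith [sq_nonneg (a - 2 * b * (p₁ + p₂))]
  calc (6 * alpha P ^ 2 * τ * (a + 2 * b * (p₁ + p₂))) ^ 2
      = 36 * alpha P ^ 4 * τ ^ 2 * (a + 2 * b * (p₁ + p₂)) ^ 2 := by ring
    _ ≤ 36 * alpha P ^ 4 * τ ^ 2 * (12 * (n * (p₁ + p₂) + b ^ 2 * (p₁ + p₂) ^ 2)) := by gcongr
    _ = _ := by ring

lemma sum_abs_sub_le_of_mem_constraintSet {P : Measure ℝ} {τ : ℝ} (hn : 0 < n) {w w' : Fin n → ℝ}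
    (hw : w ∈ constraintSet P τ β γ) (hw' : w' ∈ constraintSet P τ β γ) :
    ∑ i, |(w - w') i| ≤ 12 * τ * n := by
  have hn' : (0 : ℝ) < n := by exact_mod_cast hn
  have h1 : (∑ i, |w i|) / n ≤ 6 * τ := hw.1
  have h2 : (∑ i, |w' i|) / n ≤ 6 * τ := hw'.1
  rw [div_le_iff₀ hn'] at h1 h2
  calc ∑ i, |(w - w') i| ≤ ∑ i, (|w i| + |w' i|) := Finset.sum_le_sum fun i _ => abs_sub _ _
    _ ≤ 12 * τ * n := by rw [Finset.sum_add_distrib]; linarith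

lemma specNorm_dual_sub_le_of_mem_constraintSet {P : Measure ℝ} {τ : ℝ} {w w' : Fin n → ℝ}
    (hw : w ∈ constraintSet P τ β γ) (hw' : w' ∈ constraintSet P τ β γ) :
    specNorm (dual β γ (w - w')) ≤ 2 * specRadius P τ p₁ p₂ n := by
  have h1 : specNorm (dual β γ w) ≤ specRadius P τ p₁ p₂ n := hw.2
  have h2 : specNorm (dual β γ w') ≤ specRadius P τ p₁ p₂ n := hw'.2
  rw [dual_sub]
  linarith [specNorm_sub_le (dual β γ w) (dual β γ w')]

/-- The restricted lower `ℓ₁` bound for the design on the cone of matrices that are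
nearly of rank `r`. -/
def ConeBound (c : ℝ) (r : ℕ) (β : Fin n → Fin p₁ → ℝ) (γ : Fin n → Fin p₂ → ℝ) : Prop :=
  ∀ M : Matrix (Fin p₁) (Fin p₂) ℝ, nuclearNorm M ≤ 4 * √r * √(frobSq M) →
    c * n * √(frobSq M) ≤ ∑ i, |ropMap β γ M i|

lemma ConeBound.frobSq_le_of_sum_le {c τ : ℝ} {r : ℕ} (h : ConeBound c r β γ) (hc : 0 < c)
    (hn : 0 < n) {M : Matrix (Fin p₁) (Fin p₂) ℝ} (hM : nuclearNorm M ≤ 4 * √r * √(frobSq M))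
    (hτ : ∑ i, |ropMap β γ M i| ≤ 12 * τ * n) : frobSq M ≤ 144 / c ^ 2 * τ ^ 2 := by
  have hn' : (0 : ℝ) < n := by exact_mod_cast hn
  have h1 : c * √(frobSq M) ≤ 12 * τ := by
    have := (h M hM).trans hτ
    nlinarith
  have h2 : c ^ 2 * frobSq M ≤ 144 * τ ^ 2 := by
    have := pow_le_pow_left₀ (by positivity) h1 2
    rw [mul_pow, Real.sq_sqrt (frobSq_nonneg M)] at this
    linarith
  rw [div_mul_eq_mul_div, le_div_iff₀ (by positivity)]
  linarith

lemma ConeBound.frobSq_le_of_specNorm_le {c η : ℝ} {r : ℕ} (h : ConeBound c r β γ) (hc : 0 < c)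
    (hn : 0 < n) {M : Matrix (Fin p₁) (Fin p₂) ℝ} (hM : nuclearNorm M ≤ 4 * √r * √(frobSq M))
    (hη : specNorm (dual β γ (ropMap β γ M)) ≤ 2 * η) :
    frobSq M ≤ 64 / c ^ 4 * η ^ 2 * (r / n ^ 2) := by
  have hn' : (0 : ℝ) < n := by exact_mod_cast hn
  set f := √(frobSq M)
  have hf : 0 ≤ f := Real.sqrt_nonneg _
  have hf2 : f ^ 2 = frobSq M := Real.sq_sqrt (frobSq_nonneg M)
  have hη0 : 0 ≤ η := by linarith [specNorm_nonneg (dual β γ (ropMap β γ M))]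
  have h1 : (c * n * f) ^ 2 ≤ n * (2 * η * (4 * √r * f)) := by
    calc (c * n * f) ^ 2 ≤ (∑ i, |ropMap β γ M i|) ^ 2 :=
          pow_le_pow_left₀ (by positivity) (h M hM) 2
      _ ≤ n * ∑ i, |ropMap β γ M i| ^ 2 := by
          simpa using sq_sum_le_card_mul_sum_sq (s := Finset.univ)
            (f := fun i => |ropMap β γ M i|)
      _ = n * frobInner (dual β γ (ropMap β γ M)) M := by
          rw [frobInner_dual]
          simp only [sq_abs]
          simp only [sq]
      _ ≤ n * (specNorm (dual β γ (ropMap β γ M)) * nuclearNorm M) := by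
          gcongr; exact frobInner_le _ _
      _ ≤ n * (2 * η * (4 * √r * f)) := by
          gcongr
          exact nuclearNorm_nonneg M
  have h2 : c ^ 2 * n * f ≤ 8 * η * √r := by
    rcases hf.eq_or_lt with h0 | h0
    · rw [← h0, mul_zero]; positivity
    · refine le_of_mul_le_mul_right ?_ (mul_pos hn' h0)
      nlinarith
  have h3 := pow_le_pow_left₀ (by positivity) h2 2
  rw [mul_pow, mul_pow, mul_pow, hf2, mul_pow, Real.sq_sqrt (Nat.cast_nonneg r)] at h3
  have : 64 / c ^ 4 * η ^ 2 * (r / n ^ 2) = 64 * η ^ 2 * r / (c ^ 4 * n ^ 2) := by field_simp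
  rw [this, le_div_iff₀ (by positivity)]
  nlinarith

/-- The deterministic part of the recovery guarantee. -/
theorem frobSq_estimator_sub_le {P : Measure ℝ} {τ c : ℝ} {r : ℕ} {z : Fin n → ℝ}
    (h : ConeBound c r β γ) (hc : 0 < c) (hn : 0 < n) (hr : 0 < r)
    (hz : z ∈ constraintSet P τ β γ) (A Ahat : Matrix (Fin p₁) (Fin p₂) ℝ)
    (hA : IsEstimator P τ β γ (ropMap β γ A + z) Ahat) :
    frobSq (Ahat - A) ≤ (144 / c ^ 2 + 64 / c ^ 4 * (432 * alpha P ^ 4)) * τ ^ 2 *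
        min (r * Real.log n * (p₁ + p₂) ^ 2 / n ^ 2 + r * (p₁ + p₂) / n) 1 +
      4 * (nuclearNorm (minusMaxPart r A) ^ 2 / r) := by
  have hr' : (0 : ℝ) < r := by exact_mod_cast hr
  have hn' : (0 : ℝ) < n := by exact_mod_cast hn
  have hlog : 0 ≤ Real.log n := Real.log_natCast_nonneg n
  set H := Ahat - A with hHdef
  set a := nuclearNorm (minusMaxPart r A)
  have ha : 0 ≤ a := nuclearNorm_nonneg _
  have hnuc : nuclearNorm H ≤ 2 * a + 3 * √r * √(frobSq H) := by
    apply nuclearNorm_le_of_nuclearNorm_add_le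
    rw [hHdef, add_sub_cancel]
    apply hA.2
    simpa using hz
  have hw : ropMap β γ H = z - (ropMap β γ A + z - ropMap β γ Ahat) := by
    rw [hHdef, ropMap_sub]; abel
  have hf2 := Real.sq_sqrt (frobSq_nonneg H)
  set m := min (r * Real.log n * (p₁ + p₂) ^ 2 / n ^ 2 + r * (p₁ + p₂) / n : ℝ) 1 with hm
  have hm0 : 0 ≤ m := by positivity
  rcases le_total (2 * a) (√r * √(frobSq H)) with hcase | hcase
  · have hcone : nuclearNorm H ≤ 4 * √r * √(frobSq H) := by linarith
    have e1 := h.frobSq_le_of_sum_le hc hn hcone (τ := τ)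
      (by rw [hw]; exact sum_abs_sub_le_of_mem_constraintSet hn hz hA.1)
    have e2 := h.frobSq_le_of_specNorm_le hc hn hcone (η := specRadius P τ p₁ p₂ n)
      (by rw [hw]; exact specNorm_dual_sub_le_of_mem_constraintSet hz hA.1)
    have e3 : frobSq H ≤ (144 / c ^ 2 + 64 / c ^ 4 * (432 * alpha P ^ 4)) * τ ^ 2 * m := by
      rcases min_choice (r * Real.log n * (p₁ + p₂) ^ 2 / n ^ 2 + r * (p₁ + p₂) / n : ℝ) 1
        with h' | h'
      · have e4 : 64 / c ^ 4 * specRadius P τ p₁ p₂ n ^ 2 * (r / n ^ 2) ≤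
            64 / c ^ 4 * (432 * alpha P ^ 4 * τ ^ 2 *
              (n * (p₁ + p₂) + Real.log n * (p₁ + p₂) ^ 2)) * (r / n ^ 2) := by
          gcongr
          exact specRadius_sq_le P τ p₁ p₂ n
        have e5 : 64 / c ^ 4 * (432 * alpha P ^ 4 * τ ^ 2 *
              (n * (p₁ + p₂) + Real.log n * (p₁ + p₂) ^ 2)) * (r / n ^ 2) =
            64 / c ^ 4 * (432 * alpha P ^ 4) * τ ^ 2 * m := by
          rw [hm, h']
          field_simp
          ring
        have e6 : 0 ≤ 144 / c ^ 2 * τ ^ 2 * m := by positivity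
        linarith
      · rw [hm, h', mul_one, add_mul]
        have : 0 ≤ 64 / c ^ 4 * (432 * alpha P ^ 4) * τ ^ 2 := by positivity
        linarith
    have : 0 ≤ 4 * (a ^ 2 / r) := by positivity
    linarith
  · have e1 := pow_le_pow_left₀ (by positivity) hcase 2
    rw [mul_pow, mul_pow, hf2, Real.sq_sqrt hr'.le] at e1
    have e2 : frobSq H ≤ 4 * (a ^ 2 / r) := by
      rw [← mul_div_assoc, le_div_iff₀ hr']
      linarith
    have : 0 ≤ (144 / c ^ 2 + 64 / c ^ 4 * (432 * alpha P ^ 4)) * τ ^ 2 * m := by positivity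
    linarith

end Deterministic

section SubGaussian

open ENNReal Set

lemma IsSubGaussian.measure_sq_ge_le {ν : Measure ℝ} [IsProbabilityMeasure ν] {σ : ℝ}
    (h : IsSubGaussian ν σ) {t : ℝ} (ht : 0 < t) :
    ν {x | t ≤ x ^ 2} ≤ ENNReal.ofReal (2 * Real.exp (-t / (2 * σ ^ 2))) := by
  have h1 := h (√t) (Real.sqrt_pos.mpr ht)
  rw [Real.sq_sqrt ht.le] at h1
  have h2 : {x : ℝ | t ≤ x ^ 2} = {x | √t ≤ |x|} := by
    ext x
    simp only [mem_ofPred_eq, Real.sqrt_le_left (abs_nonneg x), sq_abs]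
  rw [h2, ← ofReal_measureReal]
  exact ENNReal.ofReal_le_ofReal h1

lemma IsSubGaussian.lintegral_exp_sq_le {ν : Measure ℝ} [IsProbabilityMeasure ν] {σ l : ℝ}
    (h : IsSubGaussian ν σ) (hσ : 0 < σ) (hl : 0 ≤ l) (hl' : 2 * l * σ ^ 2 < 1) :
    ∫⁻ x, ENNReal.ofReal (Real.exp (l * x ^ 2)) ∂ν ≤
      ENNReal.ofReal (1 + 4 * l * σ ^ 2 / (1 - 2 * l * σ ^ 2)) := by
  have hprim : ∀ y : ℝ, ∫ t in (0 : ℝ)..y, l * Real.exp (l * t) = Real.exp (l * y) - 1 := by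
    intro y
    rw [intervalIntegral.integral_eq_sub_of_hasDerivAt (f := fun t => Real.exp (l * t))]
    · simp
    · intro t _
      have := ((hasDerivAt_id t).const_mul l).exp
      simpa [mul_comm] using this
    · exact (by fun_prop : Continuous fun t => l * Real.exp (l * t)).intervalIntegrable _ _
  have hlayer := lintegral_comp_eq_lintegral_meas_le_mul ν (f := fun x : ℝ => x ^ 2)
    (g := fun t => l * Real.exp (l * t)) (Filter.Eventually.of_forall fun x => sq_nonneg x)
    (by fun_prop)
    (fun t _ => (by fun_prop : Continuous fun t => l * Real.exp (l * t)).intervalIntegrable _ _)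
    (Filter.Eventually.of_forall fun t => by positivity)
  have hsplit : ∀ x : ℝ, ENNReal.ofReal (Real.exp (l * x ^ 2)) =
      1 + ENNReal.ofReal (∫ t in (0 : ℝ)..x ^ 2, l * Real.exp (l * t)) := fun x => by
    rw [hprim, ← ENNReal.ofReal_one, ← ENNReal.ofReal_add zero_le_one]
    · congr 1; ring
    · linarith [Real.one_le_exp (show 0 ≤ l * x ^ 2 by positivity)]
  have hσ2 : 0 < σ ^ 2 := by positivity
  set b := 1 / (2 * σ ^ 2) - l with hb
  have hb0 : 0 < b := by
    rw [hb, sub_pos, lt_div_iff₀ (by positivity)]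
    linarith
  have hInt : IntegrableOn (fun t => 2 * l * Real.exp (-b * t)) (Ioi 0) :=
    (integrableOn_exp_mul_Ioi (neg_lt_zero.mpr hb0) 0).const_mul _
  have hval : ∫ t in Ioi (0 : ℝ), 2 * l * Real.exp (-b * t) =
      4 * l * σ ^ 2 / (1 - 2 * l * σ ^ 2) := by
    rw [integral_const_mul, integral_exp_mul_Ioi (neg_lt_zero.mpr hb0)]
    have : 1 - 2 * l * σ ^ 2 = 2 * σ ^ 2 * b := by rw [hb]; field_simp
    rw [this]
    simp
    field_simp
    ring
  rw [lintegral_congr hsplit, lintegral_add_left measurable_const, hlayer, lintegral_const,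
    measure_univ, mul_one, ENNReal.ofReal_add zero_le_one (div_nonneg (by positivity) (by linarith)),
    ENNReal.ofReal_one]
  gcongr
  rw [← hval, ofReal_integral_eq_lintegral_ofReal hInt
    (Filter.Eventually.of_forall fun t => by positivity)]
  refine setLIntegral_mono' measurableSet_Ioi fun t ht => ?_
  calc ν {x | t ≤ x ^ 2} * ENNReal.ofReal (l * Real.exp (l * t))
      ≤ ENNReal.ofReal (2 * Real.exp (-t / (2 * σ ^ 2))) *
        ENNReal.ofReal (l * Real.exp (l * t)) := by
        gcongr
        exact h.measure_sq_ge_le ht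
    _ = ENNReal.ofReal (2 * l * Real.exp (-b * t)) := by
        rw [← ENNReal.ofReal_mul (by positivity)]
        congr 1
        have : -b * t = -t / (2 * σ ^ 2) + l * t := by rw [hb]; ring
        rw [this, Real.exp_add]
        ring

variable {P : Measure ℝ} [IsProbabilityMeasure P] {σ : ℝ}

lemma pow_mul_le_factorial_mul_exp {l : ℝ} (hl : 0 ≤ l) (k : ℕ) (x : ℝ) :
    l ^ k * x ^ (2 * k) ≤ k.factorial * Real.exp (l * x ^ 2) := by
  have := Real.pow_div_factorial_le_exp (l * x ^ 2) (by positivity) k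
  rw [div_le_iff₀ (by positivity), mul_pow, ← pow_mul] at this
  linarith

lemma IsSubGaussian.integrable_exp_sq (h : IsSubGaussian P σ) (hσ : 0 < σ) :
    Integrable (fun x => Real.exp (1 / (4 * σ ^ 2) * x ^ 2)) P ∧
      ∫ x, Real.exp (1 / (4 * σ ^ 2) * x ^ 2) ∂P ≤ 3 := by
  have h1 := h.lintegral_exp_sq_le hσ (l := 1 / (4 * σ ^ 2)) (by positivity)
    (by field_simp; norm_num)
  have h2 : (1 + 4 * (1 / (4 * σ ^ 2)) * σ ^ 2 / (1 - 2 * (1 / (4 * σ ^ 2)) * σ ^ 2)) = 3 := by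
    field_simp; norm_num
  rw [h2] at h1
  have hm : AEStronglyMeasurable (fun x => Real.exp (1 / (4 * σ ^ 2) * x ^ 2)) P := by fun_prop
  have hnn : 0 ≤ᵐ[P] fun x => Real.exp (1 / (4 * σ ^ 2) * x ^ 2) :=
    Filter.Eventually.of_forall fun x => (Real.exp_pos _).le
  refine ⟨⟨hm, ?_⟩, ?_⟩
  · rw [hasFiniteIntegral_iff_ofReal hnn]
    exact h1.trans_lt ENNReal.ofReal_lt_top
  · rw [integral_eq_lintegral_of_nonneg_ae hnn hm]
    exact ENNReal.toReal_le_of_le_ofReal (by norm_num) h1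

lemma IsSubGaussian.integrable_pow_two_mul (h : IsSubGaussian P σ) (hσ : 0 < σ) (k : ℕ) :
    Integrable (fun x : ℝ => x ^ (2 * k)) P := by
  obtain ⟨h1, -⟩ := h.integrable_exp_sq hσ
  refine (h1.const_mul (k.factorial * (4 * σ ^ 2) ^ k)).mono' (by fun_prop)
    (Filter.Eventually.of_forall fun x => ?_)
  have := pow_mul_le_factorial_mul_exp (l := 1 / (4 * σ ^ 2)) (by positivity) k x
  rw [Real.norm_of_nonneg (by rw [pow_mul]; positivity)]
  rw [div_pow, one_pow, div_mul_eq_mul_div, one_mul, div_le_iff₀ (by positivity)] at this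
  linarith

lemma IsSubGaussian.integral_pow_two_mul_le (h : IsSubGaussian P σ) (hσ : 0 < σ) (k : ℕ) :
    ∫ x, x ^ (2 * k) ∂P ≤ 3 * k.factorial * (4 * σ ^ 2) ^ k := by
  obtain ⟨h1, h2⟩ := h.integrable_exp_sq hσ
  calc ∫ x, x ^ (2 * k) ∂P
      ≤ ∫ x, k.factorial * (4 * σ ^ 2) ^ k * Real.exp (1 / (4 * σ ^ 2) * x ^ 2) ∂P := by
        refine integral_mono (h.integrable_pow_two_mul hσ k) (h1.const_mul _) fun x => ?_
        have := pow_mul_le_factorial_mul_exp (l := 1 / (4 * σ ^ 2)) (by positivity) k x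
        rw [div_pow, one_pow, div_mul_eq_mul_div, one_mul, div_le_iff₀ (by positivity)] at this
        dsimp only
        linarith
    _ ≤ k.factorial * (4 * σ ^ 2) ^ k * 3 := by
        rw [integral_const_mul]
        gcongr
    _ = _ := by ring

lemma factorial_le_doubleFactorial (k : ℕ) :
    (k.factorial : ℝ) ≤ (Nat.doubleFactorial (2 * k - 1) : ℝ) := by
  norm_cast
  induction k with
  | zero => simp
  | succ k ih =>
    rcases k with - | k
    · simp
    · have : 2 * (k + 1 + 1) - 1 = (2 * (k + 1) - 1) + 2 := by omega
      rw [this, Nat.doubleFactorial_add_two, Nat.factorial_succ]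
      exact Nat.mul_le_mul (by omega) ih

lemma IsSubGaussian.bddAbove_alpha (h : IsSubGaussian P σ) (hσ : 0 < σ) :
    BddAbove (Set.range fun k : ℕ+ =>
      ((∫ x, x ^ (2 * (k : ℕ)) ∂P) / (Nat.doubleFactorial (2 * (k : ℕ) - 1) : ℝ)) ^
        ((1 : ℝ) / (2 * (k : ℕ)))) := by
  refine ⟨√(12 * σ ^ 2), ?_⟩
  rintro _ ⟨k, rfl⟩
  have hk : 0 < (k : ℕ) := k.pos
  have hd : (0 : ℝ) < (Nat.doubleFactorial (2 * (k : ℕ) - 1) : ℝ) := by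
    exact_mod_cast Nat.doubleFactorial_pos _
  have h0 : 0 ≤ ∫ x, x ^ (2 * (k : ℕ)) ∂P :=
    integral_nonneg fun x => by dsimp only; rw [pow_mul]; positivity
  have h1 : (∫ x, x ^ (2 * (k : ℕ)) ∂P) / (Nat.doubleFactorial (2 * (k : ℕ) - 1) : ℝ) ≤
      √(12 * σ ^ 2) ^ (2 * (k : ℕ)) := by
    rw [div_le_iff₀ hd, pow_mul, Real.sq_sqrt (by positivity)]
    calc ∫ x, x ^ (2 * (k : ℕ)) ∂P ≤ 3 * (k : ℕ).factorial * (4 * σ ^ 2) ^ (k : ℕ) :=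
          h.integral_pow_two_mul_le hσ k
      _ ≤ 3 ^ (k : ℕ) * (Nat.doubleFactorial (2 * (k : ℕ) - 1) : ℝ) * (4 * σ ^ 2) ^ (k : ℕ) := by
          gcongr
          · exact le_self_pow₀ (by norm_num) hk.ne'
          · exact_mod_cast factorial_le_doubleFactorial (k : ℕ)
      _ = (12 * σ ^ 2) ^ (k : ℕ) * (Nat.doubleFactorial (2 * (k : ℕ) - 1) : ℝ) := by
          rw [show 12 * σ ^ 2 = 3 * (4 * σ ^ 2) by ring, mul_pow 3]; ring
  calc _ ≤ (√(12 * σ ^ 2) ^ (2 * (k : ℕ))) ^ ((1 : ℝ) / (2 * (k : ℕ))) := by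
        dsimp only
        gcongr
    _ = √(12 * σ ^ 2) := by
        rw [← Real.rpow_natCast, ← Real.rpow_mul (Real.sqrt_nonneg _)]
        push_cast
        rw [mul_one_div_cancel (by positivity), Real.rpow_one]

lemma IsSubGaussian.integral_pow_le_alpha (h : IsSubGaussian P σ) (hσ : 0 < σ) (k : ℕ) :
    ∫ x, x ^ (2 * k) ∂P ≤ alpha P ^ (2 * k) * (Nat.doubleFactorial (2 * k - 1) : ℝ) := by
  rcases k.eq_zero_or_pos with rfl | hk
  · simp
  have hd : (0 : ℝ) < (Nat.doubleFactorial (2 * k - 1) : ℝ) := by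
    exact_mod_cast Nat.doubleFactorial_pos _
  have h0 : 0 ≤ ∫ x, x ^ (2 * k) ∂P :=
    integral_nonneg fun x => by dsimp only; rw [pow_mul]; positivity
  rw [← div_le_iff₀ hd]
  have h1 := le_ciSup (h.bddAbove_alpha hσ) ⟨k, hk⟩
  have h2 := pow_le_pow_left₀ (by positivity) h1 (2 * k)
  rw [PNat.mk_coe, ← Real.rpow_natCast, ← Real.rpow_mul (by positivity)] at h2
  push_cast at h2
  rw [one_div_mul_cancel (by positivity), Real.rpow_one] at h2
  exact h2

omit [IsProbabilityMeasure P] in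
lemma IsSymmetric.measurePreserving_neg (h : IsSymmetric P) :
    MeasurePreserving (fun x : ℝ => -x) P P := ⟨measurable_neg, h⟩

omit [IsProbabilityMeasure P] in
lemma IsSymmetric.integral_id (h : IsSymmetric P) : ∫ x, x ∂P = 0 := by
  have h1 : ∫ x, x ∂P = ∫ x, -x ∂P :=
    (h.measurePreserving_neg.integral_comp (MeasurableEquiv.neg ℝ).measurableEmbedding id).symm
  rw [integral_neg] at h1
  linarith

omit [IsProbabilityMeasure P] in
lemma IsSymmetric.integral_sq (h : IsSymmetric P) (hvar : Var[id; P] = 1) :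
    ∫ x, x ^ 2 ∂P = 1 := by
  rw [variance_eq_integral aemeasurable_id] at hvar
  simpa [h.integral_id] using hvar

lemma IsSubGaussian.one_le_alpha (h : IsSubGaussian P σ) (hσ : 0 < σ)
    (h2 : ∫ x, x ^ 2 ∂P = 1) : 1 ≤ alpha P := by
  have h1 := le_ciSup (h.bddAbove_alpha hσ) 1
  refine le_trans (le_of_eq ?_) h1
  simp [h2]

lemma hasSum_exp_sq_half (y : ℝ) :
    HasSum (fun k : ℕ => y ^ (2 * k) * (Nat.doubleFactorial (2 * k - 1) : ℝ) / (2 * k).factorial)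
      (Real.exp (y ^ 2 / 2)) := by
  have h := NormedSpace.expSeries_div_hasSum_exp (y ^ 2 / 2)
  rw [← Real.exp_eq_exp_ℝ] at h
  convert! h using 2 with k
  rcases k with - | k
  · simp
  have h1 : ((2 * (k + 1)).factorial : ℝ) =
      2 ^ (k + 1) * (k + 1).factorial * (Nat.doubleFactorial (2 * (k + 1) - 1) : ℝ) := by
    have h2 := Nat.factorial_eq_mul_doubleFactorial (2 * k + 1)
    rw [show 2 * k + 1 + 1 = 2 * (k + 1) by ring, Nat.doubleFactorial_two_mul] at h2
    rw [show 2 * (k + 1) - 1 = 2 * k + 1 by omega]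
    exact_mod_cast h2
  have hd : (0 : ℝ) < (Nat.doubleFactorial (2 * (k + 1) - 1) : ℝ) := by
    exact_mod_cast Nat.doubleFactorial_pos _
  rw [h1, div_pow, pow_mul]
  field_simp

lemma IsSubGaussian.lintegral_exp_le (h : IsSubGaussian P σ) (hσ : 0 < σ) (hs : IsSymmetric P)
    (t : ℝ) :
    ∫⁻ x, ENNReal.ofReal (Real.exp (t * x)) ∂P ≤
      ENNReal.ofReal (Real.exp (alpha P ^ 2 * t ^ 2 / 2)) := by
  have hsym : ∫⁻ x, ENNReal.ofReal (Real.exp (t * x)) ∂P =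
      ∫⁻ x, ENNReal.ofReal (Real.exp (-(t * x))) ∂P := by
    have := hs.measurePreserving_neg.lintegral_comp
      (f := fun x => ENNReal.ofReal (Real.exp (t * x))) (by fun_prop)
    rw [← this]
    simp
  have hcosh : ∫⁻ x, ENNReal.ofReal (Real.exp (t * x)) ∂P =
      ∫⁻ x, ENNReal.ofReal (Real.cosh (t * x)) ∂P := by
    have h2 : 2 * ∫⁻ x, ENNReal.ofReal (Real.cosh (t * x)) ∂P =
        2 * ∫⁻ x, ENNReal.ofReal (Real.exp (t * x)) ∂P := by
      conv_rhs => rw [two_mul]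
      nth_rw 2 [hsym]
      rw [← lintegral_add_left (by fun_prop), ← lintegral_const_mul _ (by fun_prop)]
      refine lintegral_congr fun x => ?_
      rw [← ENNReal.ofReal_add (by positivity) (by positivity), Real.cosh_eq,
        show (2 : ℝ≥0∞) = ENNReal.ofReal 2 by simp, ← ENNReal.ofReal_mul (by norm_num)]
      congr 1
      ring
    exact ((ENNReal.mul_right_inj two_ne_zero ofNat_ne_top).mp h2).symm
  have hser : ∀ x : ℝ, ENNReal.ofReal (Real.cosh (t * x)) =
      ∑' k : ℕ, ENNReal.ofReal ((t * x) ^ (2 * k) / (2 * k).factorial) := fun x => by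
    rw [← (Real.hasSum_cosh (t * x)).tsum_eq, ENNReal.ofReal_tsum_of_nonneg]
    · intro k; rw [pow_mul]; positivity
    · exact (Real.hasSum_cosh (t * x)).summable
  rw [hcosh, lintegral_congr hser, lintegral_tsum (fun k => by fun_prop)]
  have hsum := hasSum_exp_sq_half (alpha P * t)
  rw [mul_pow] at hsum
  rw [← hsum.tsum_eq, ENNReal.ofReal_tsum_of_nonneg
    (fun k => by rw [pow_mul]; positivity) hsum.summable]
  refine ENNReal.tsum_le_tsum fun k => ?_
  rw [← ofReal_integral_eq_lintegral_ofReal]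
  · apply ENNReal.ofReal_le_ofReal
    simp only [mul_pow]
    rw [integral_div, integral_const_mul]
    have ht : 0 ≤ t ^ (2 * k) := by rw [pow_mul]; positivity
    have := mul_le_mul_of_nonneg_left (h.integral_pow_le_alpha hσ k) ht
    apply div_le_div_of_nonneg_right _ (Nat.cast_nonneg _)
    linarith
  · simp only [mul_pow]
    exact ((h.integrable_pow_two_mul hσ k).const_mul _).div_const _
  · exact Filter.Eventually.of_forall fun x => by
      dsimp only
      rw [pow_mul]; positivity

end SubGaussian

section BilinearMGF

open ENNReal Set

/-- The moment generating function of `P` is dominated by that of a centred Gaussian with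
standard deviation `a`. -/
def MGFBound (P : Measure ℝ) (a : ℝ) : Prop :=
  ∀ t : ℝ, ∫⁻ x, ENNReal.ofReal (Real.exp (t * x)) ∂P ≤ ENNReal.ofReal (Real.exp (a ^ 2 * t ^ 2 / 2))

lemma lintegral_pi_prod {ι : Type*} [Fintype ι] {X : ι → Type*} [∀ i, MeasurableSpace (X i)]
    (μ : ∀ i, Measure (X i)) [∀ i, IsProbabilityMeasure (μ i)] {f : ∀ i, X i → ℝ≥0∞}
    (hf : ∀ i, Measurable (f i)) :
    ∫⁻ x, ∏ i, f i (x i) ∂(Measure.pi μ) = ∏ i, ∫⁻ x, f i x ∂(μ i) := by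
  rw [lintegral_prod_eq_prod_lintegral_of_indepFun Finset.univ
    (fun i (x : ∀ i, X i) => f i (x i)) (iIndepFun_pi fun i => (hf i).aemeasurable)
    (fun i => (hf i).comp (measurable_pi_apply i))]
  exact Finset.prod_congr rfl fun i _ => (measurePreserving_eval μ i).lintegral_comp (hf i)

variable {P : Measure ℝ} [IsProbabilityMeasure P] {a : ℝ}

lemma MGFBound.lintegral_pi_le (h : MGFBound P a) {p : ℕ} (w : Fin p → ℝ) :
    ∫⁻ b, ENNReal.ofReal (Real.exp (w ⬝ᵥ b)) ∂(Measure.pi fun _ => P) ≤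
      ENNReal.ofReal (Real.exp (a ^ 2 * (w ⬝ᵥ w) / 2)) := by
  have h1 : ∀ b : Fin p → ℝ, ENNReal.ofReal (Real.exp (w ⬝ᵥ b)) =
      ∏ i, ENNReal.ofReal (Real.exp (w i * b i)) := fun b => by
    rw [dotProduct, Real.exp_sum, ENNReal.ofReal_prod_of_nonneg fun _ _ => (Real.exp_pos _).le]
  rw [lintegral_congr h1, lintegral_pi_prod (fun _ => P)
    (f := fun i x => ENNReal.ofReal (Real.exp (w i * x))) (fun i => by fun_prop)]
  refine (Finset.prod_le_prod' fun i _ => h (w i)).trans_eq ?_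
  rw [← ENNReal.ofReal_prod_of_nonneg fun _ _ => (Real.exp_pos _).le, ← Real.exp_sum, dotProduct,
    Finset.mul_sum, Finset.sum_div]
  simp only [sq]

lemma lintegral_exp_mul_gaussianReal (c : ℝ) :
    ∫⁻ x, ENNReal.ofReal (Real.exp (c * x)) ∂(gaussianReal 0 1) =
      ENNReal.ofReal (Real.exp (c ^ 2 / 2)) := by
  have h := congrFun (mgf_id_gaussianReal (μ := 0) (v := 1)) c
  rw [mgf] at h
  rw [← ofReal_integral_eq_lintegral_ofReal (integrable_exp_mul_gaussianReal c)
    (Filter.Eventually.of_forall fun _ => (Real.exp_pos _).le)]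
  simp only [id] at h
  rw [h]
  simp

lemma lintegral_exp_sq_gaussianReal {b : ℝ} (hb : b < 1) :
    ∫⁻ x, ENNReal.ofReal (Real.exp (b * x ^ 2 / 2)) ∂(gaussianReal 0 1) =
      ENNReal.ofReal (√(1 - b))⁻¹ := by
  have hb' : 0 < (1 - b) / 2 := by linarith
  rw [gaussianReal_of_var_ne_zero 0 one_ne_zero,
    lintegral_withDensity_eq_lintegral_mul _ (measurable_gaussianPDF 0 1) (by fun_prop)]
  have h1 : ∀ x : ℝ, (gaussianPDF 0 1 * fun x => ENNReal.ofReal (Real.exp (b * x ^ 2 / 2))) x =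
      ENNReal.ofReal ((√(2 * Real.pi))⁻¹ * Real.exp (-((1 - b) / 2) * x ^ 2)) := fun x => by
    rw [Pi.mul_apply, gaussianPDF, gaussianPDFReal, ← ENNReal.ofReal_mul (by positivity)]
    simp only [sub_zero, NNReal.coe_one, mul_one]
    rw [mul_assoc, ← Real.exp_add]
    congr 3
    ring
  rw [lintegral_congr h1, ← ofReal_integral_eq_lintegral_ofReal
    ((integrable_exp_neg_mul_sq hb').const_mul _)
    (Filter.Eventually.of_forall fun _ => by positivity),
    integral_const_mul, integral_gaussian]
  congr 1
  rw [← Real.sqrt_inv, ← Real.sqrt_inv, ← Real.sqrt_mul (by positivity)]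
  congr 1
  have : 1 - b ≠ 0 := by linarith
  field_simp

lemma inv_sqrt_one_sub_le_exp {x : ℝ} (h0 : 0 ≤ x) (h1 : x ≤ 16 / 25) :
    (√(1 - x))⁻¹ ≤ Real.exp (4 / 5 * x) := by
  have hx : 0 < 1 - x := by linarith
  have hlog : -(8 / 5 * x) ≤ Real.log (1 - x) := by
    have e1 : Real.log (25 / 9) ≤ 1.024 := by
      rw [Real.log_le_iff_le_exp (by norm_num)]
      have h2 := Real.add_one_le_exp (0.024 : ℝ)
      have h3 := Real.exp_one_gt_d9
      rw [show (1.024 : ℝ) = 1 + 0.024 by norm_num, Real.exp_add]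
      nlinarith
    have e2 : Real.log (9 / 25) = -Real.log (25 / 9) := by
      rw [← Real.log_inv]; norm_num
    have h4 := strictConcaveOn_log_Ioi.concaveOn.2 (show (9 / 25 : ℝ) ∈ Ioi 0 by norm_num)
      (show (1 : ℝ) ∈ Ioi 0 by norm_num) (show 0 ≤ 25 / 16 * x by positivity)
      (show 0 ≤ 1 - 25 / 16 * x by linarith) (by ring)
    simp only [smul_eq_mul, Real.log_one, mul_zero, add_zero] at h4
    rw [show 25 / 16 * x * (9 / 25) + (1 - 25 / 16 * x) * 1 = 1 - x by ring, e2] at h4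
    nlinarith
  have h5 : Real.exp (-(4 / 5 * x)) ≤ √(1 - x) := by
    apply Real.le_sqrt_of_sq_le
    rw [← Real.exp_nat_mul, ← Real.le_log_iff_exp_le hx]
    push_cast
    linarith
  rw [inv_le_comm₀ (Real.sqrt_pos.mpr hx) (Real.exp_pos _), ← Real.exp_neg]
  exact h5

lemma MGFBound.lintegral_exp_sq_le (h : MGFBound P a) {p : ℕ} {v : Fin p → ℝ} (hv : v ⬝ᵥ v ≤ 1)
    {c : ℝ} (hc : 0 ≤ c) (hca : c * a ^ 2 < 1) :
    ∫⁻ g, ENNReal.ofReal (Real.exp (c * (v ⬝ᵥ g) ^ 2 / 2)) ∂(Measure.pi fun _ => P) ≤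
      ENNReal.ofReal (√(1 - c * a ^ 2))⁻¹ := by
  have h1 : ∀ g : Fin p → ℝ, ENNReal.ofReal (Real.exp (c * (v ⬝ᵥ g) ^ 2 / 2)) =
      ∫⁻ x, ENNReal.ofReal (Real.exp (√c * (v ⬝ᵥ g) * x)) ∂(gaussianReal 0 1) := fun g => by
    rw [lintegral_exp_mul_gaussianReal, mul_pow, Real.sq_sqrt hc]
  have hm : Continuous fun q : (Fin p → ℝ) × ℝ => Real.exp (√c * (v ⬝ᵥ q.1) * q.2) := by
    unfold dotProduct; fun_prop
  rw [lintegral_congr h1, lintegral_lintegral_swap hm.measurable.ennreal_ofReal.aemeasurable,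
    ← lintegral_exp_sq_gaussianReal hca]
  refine lintegral_mono fun x => ?_
  have h2 : ∀ g : Fin p → ℝ, √c * (v ⬝ᵥ g) * x = ((√c * x) • v) ⬝ᵥ g := fun g => by
    rw [smul_dotProduct, smul_eq_mul]; ring
  simp only [h2]
  refine (h.lintegral_pi_le _).trans (ENNReal.ofReal_le_ofReal (Real.exp_le_exp.mpr ?_))
  rw [smul_dotProduct, dotProduct_smul, smul_eq_mul, smul_eq_mul]
  have h3 : √c * x * (√c * x * (v ⬝ᵥ v)) = c * x ^ 2 * (v ⬝ᵥ v) := by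
    calc _ = √c ^ 2 * x ^ 2 * (v ⬝ᵥ v) := by ring
      _ = _ := by rw [Real.sq_sqrt hc]
  rw [h3]
  have h4 : c * x ^ 2 * (v ⬝ᵥ v) ≤ c * x ^ 2 := mul_le_of_le_one_right (by positivity) hv
  nlinarith [sq_nonneg a]

/-- The law of a pair `(β, γ)` with i.i.d. entries. -/
noncomputable abbrev pairLaw (P : Measure ℝ) (p₁ p₂ : ℕ) : Measure ((Fin p₁ → ℝ) × (Fin p₂ → ℝ)) :=
  (Measure.pi fun _ => P).prod (Measure.pi fun _ => P)

lemma MGFBound.lintegral_pairLaw_le (h : MGFBound P a) {p₁ p₂ : ℕ} {u : Fin p₁ → ℝ}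
    {v : Fin p₂ → ℝ} (hu : u ⬝ᵥ u ≤ 1) (hv : v ⬝ᵥ v ≤ 1) {t : ℝ} (ht : |t| * a ^ 2 ≤ 4 / 5) :
    ∫⁻ q, ENNReal.ofReal (Real.exp (t * ((u ⬝ᵥ q.1) * (v ⬝ᵥ q.2)))) ∂(pairLaw P p₁ p₂) ≤
      ENNReal.ofReal (Real.exp (4 / 5 * (t * a ^ 2) ^ 2)) := by
  have hsq : (t * a ^ 2) ^ 2 ≤ 16 / 25 := by
    rw [← sq_abs, abs_mul, abs_of_nonneg (sq_nonneg a)]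
    nlinarith [show 0 ≤ |t| * a ^ 2 by positivity]
  have hm : Continuous fun q : (Fin p₁ → ℝ) × (Fin p₂ → ℝ) =>
      Real.exp (t * ((u ⬝ᵥ q.1) * (v ⬝ᵥ q.2))) := by
    unfold dotProduct; fun_prop
  rw [lintegral_prod_symm _ hm.measurable.ennreal_ofReal.aemeasurable]
  have hc : t ^ 2 * a ^ 2 * a ^ 2 = (t * a ^ 2) ^ 2 := by ring
  calc _ ≤ ∫⁻ g, ENNReal.ofReal (Real.exp (t ^ 2 * a ^ 2 * (v ⬝ᵥ g) ^ 2 / 2))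
        ∂(Measure.pi fun _ => P) := by
        refine lintegral_mono fun g => ?_
        have h2 : ∀ b : Fin p₁ → ℝ, t * ((u ⬝ᵥ b) * (v ⬝ᵥ g)) = ((t * (v ⬝ᵥ g)) • u) ⬝ᵥ b :=
          fun b => by rw [smul_dotProduct, smul_eq_mul]; ring
        simp only [h2]
        refine (h.lintegral_pi_le _).trans (ENNReal.ofReal_le_ofReal (Real.exp_le_exp.mpr ?_))
        rw [smul_dotProduct, dotProduct_smul, smul_eq_mul, smul_eq_mul]
        have : (t * (v ⬝ᵥ g) * a) ^ 2 * (u ⬝ᵥ u) ≤ (t * (v ⬝ᵥ g) * a) ^ 2 :=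
          mul_le_of_le_one_right (sq_nonneg _) hu
        nlinarith
    _ ≤ ENNReal.ofReal (√(1 - t ^ 2 * a ^ 2 * a ^ 2))⁻¹ :=
        h.lintegral_exp_sq_le hv (by positivity) (by rw [hc]; linarith)
    _ ≤ _ := by
        rw [hc]
        exact ENNReal.ofReal_le_ofReal (inv_sqrt_one_sub_le_exp (sq_nonneg _) hsq)

/-- The law of the design. -/
noncomputable abbrev designLaw (P : Measure ℝ) (p₁ p₂ n : ℕ) :
    Measure (Fin n → (Fin p₁ → ℝ) × (Fin p₂ → ℝ)) :=
  Measure.pi fun _ => pairLaw P p₁ p₂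

lemma MGFBound.lintegral_designLaw_le (h : MGFBound P a) {p₁ p₂ n : ℕ} {u : Fin p₁ → ℝ}
    {v : Fin p₂ → ℝ} (hu : u ⬝ᵥ u ≤ 1) (hv : v ⬝ᵥ v ≤ 1) {t : Fin n → ℝ}
    (ht : ∀ i, |t i| * a ^ 2 ≤ 4 / 5) :
    ∫⁻ d, ENNReal.ofReal (Real.exp (∑ i, t i * ((u ⬝ᵥ (d i).1) * (v ⬝ᵥ (d i).2))))
        ∂(designLaw P p₁ p₂ n) ≤
      ENNReal.ofReal (Real.exp (4 / 5 * a ^ 4 * ∑ i, t i ^ 2)) := by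
  have h1 : ∀ d : Fin n → (Fin p₁ → ℝ) × (Fin p₂ → ℝ),
      ENNReal.ofReal (Real.exp (∑ i, t i * ((u ⬝ᵥ (d i).1) * (v ⬝ᵥ (d i).2)))) =
      ∏ i, ENNReal.ofReal (Real.exp (t i * ((u ⬝ᵥ (d i).1) * (v ⬝ᵥ (d i).2)))) := fun d => by
    rw [Real.exp_sum, ENNReal.ofReal_prod_of_nonneg fun _ _ => (Real.exp_pos _).le]
  have hm : ∀ i, Continuous fun q : (Fin p₁ → ℝ) × (Fin p₂ → ℝ) =>
      Real.exp (t i * ((u ⬝ᵥ q.1) * (v ⬝ᵥ q.2))) := by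
    unfold dotProduct; fun_prop
  rw [lintegral_congr h1, lintegral_pi_prod (fun _ => pairLaw P p₁ p₂)
    (f := fun i q => ENNReal.ofReal (Real.exp (t i * ((u ⬝ᵥ q.1) * (v ⬝ᵥ q.2)))))
    (fun i => (hm i).measurable.ennreal_ofReal)]
  refine (Finset.prod_le_prod' fun i _ => h.lintegral_pairLaw_le hu hv (ht i)).trans_eq ?_
  rw [← ENNReal.ofReal_prod_of_nonneg fun _ _ => (Real.exp_pos _).le, ← Real.exp_sum,
    Finset.mul_sum]
  congr 2
  exact Finset.sum_congr rfl fun i _ => by ring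

end BilinearMGF

section Comparison

open ENNReal

variable {E ι : Type*} [MeasurableSpace E] {Q : Measure E} [IsProbabilityMeasure Q] [Countable ι]

/-- A comparison of suprema in one variable tensorizes. -/
lemma lintegral_iSup_prod_le {φ ψ : ι → E → ℝ≥0∞} (hφ : ∀ i, Measurable (φ i))
    (hψ : ∀ i, Measurable (ψ i))
    (hstep : ∀ G : ι → ℝ≥0∞, ∫⁻ e, ⨆ i, G i * φ i e ∂Q ≤ ∫⁻ e, ⨆ i, G i * ψ i e ∂Q) (n : ℕ) :
    ∀ G : ι → ℝ≥0∞,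
      ∫⁻ d, ⨆ i, G i * ∏ k, φ i (d k) ∂(Measure.pi fun _ : Fin n => Q) ≤
        ∫⁻ d, ⨆ i, G i * ∏ k, ψ i (d k) ∂(Measure.pi fun _ : Fin n => Q) := by
  have hsplit : ∀ (n : ℕ) (G : ι → ℝ≥0∞) {χ : ι → E → ℝ≥0∞}, (∀ i, Measurable (χ i)) →
      ∫⁻ d, ⨆ i, G i * ∏ k, χ i (d k) ∂(Measure.pi fun _ : Fin (n + 1) => Q) =
      ∫⁻ q, ⨆ i, G i * (χ i q.1 * ∏ k, χ i (q.2 k)) ∂(Q.prod (Measure.pi fun _ : Fin n => Q)) := by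
    intro n G χ hχ
    rw [← (measurePreserving_piFinSuccAbove (fun _ : Fin (n + 1) => Q) 0).lintegral_comp]
    · refine lintegral_congr fun d => ?_
      simp [Fin.prod_univ_succ, MeasurableEquiv.piFinSuccAbove, Fin.tail]
    · fun_prop
  induction n with
  | zero => intro G; simp
  | succ n ih =>
    intro G
    rw [hsplit n G hφ, hsplit n G hψ, lintegral_prod_symm _ (by fun_prop)]
    calc _ = ∫⁻ d, ∫⁻ e, ⨆ i, (G i * ∏ k, φ i (d k)) * φ i e ∂Q
            ∂(Measure.pi fun _ : Fin n => Q) := by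
          simp only [mul_assoc, mul_comm (∏ k, _)]
      _ ≤ ∫⁻ d, ∫⁻ e, ⨆ i, (G i * ∏ k, φ i (d k)) * ψ i e ∂Q
            ∂(Measure.pi fun _ : Fin n => Q) := lintegral_mono fun d => hstep _
      _ = ∫⁻ e, ∫⁻ d, ⨆ i, (G i * ψ i e) * ∏ k, φ i (d k) ∂(Measure.pi fun _ : Fin n => Q) ∂Q := by
          rw [lintegral_lintegral_swap]
          · simp only [mul_right_comm]
          · fun_prop
      _ ≤ ∫⁻ e, ∫⁻ d, ⨆ i, (G i * ψ i e) * ∏ k, ψ i (d k) ∂(Measure.pi fun _ : Fin n => Q) ∂Q :=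
          lintegral_mono fun e => ih _
      _ = _ := by
          rw [lintegral_prod _ (by fun_prop)]
          simp only [mul_assoc]

lemma two_mul_exp_sub_le (c y : ℝ) :
    2 * Real.exp (c - y) ≤ Real.exp (2 * c) + Real.exp (-2 * y) := by
  have h1 : Real.exp (2 * c) = Real.exp c ^ 2 := by rw [← Real.exp_nat_mul]; simp
  have h2 : Real.exp (-2 * y) = Real.exp (-y) ^ 2 := by rw [← Real.exp_nat_mul]; congr 1; simp
  rw [sub_eq_add_neg, Real.exp_add, h1, h2]
  nlinarith [sq_nonneg (Real.exp c - Real.exp (-y))]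

/-- Comparison of the lower deviations of `|xᵢ|` with the deviations of a symmetric process `xᵢ`:
symmetrization and contraction in one step. -/
lemma lintegral_iSup_exp_sub_abs_le {x : ι → E → ℝ} (hx : ∀ i, Measurable (x i)) {S : E → E}
    (hS : MeasurePreserving S Q Q) (hxS : ∀ i e, x i (S e) = -x i e) {c : ι → ℝ}
    (hc : ∀ i, ENNReal.ofReal (Real.exp (2 * c i)) ≤
      ∫⁻ e, ENNReal.ofReal (Real.exp (2 * |x i e|)) ∂Q) (G : ι → ℝ≥0∞) :
    ∫⁻ e, ⨆ i, G i * ENNReal.ofReal (Real.exp (c i - |x i e|)) ∂Q ≤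
      ∫⁻ e, ⨆ i, G i * ENNReal.ofReal (Real.exp (2 * x i e)) ∂Q := by
  rcases isEmpty_or_nonempty ι with hι | hι
  · simp
  have hsymm : ∫⁻ e, ⨆ i, G i * ENNReal.ofReal (Real.exp (2 * x i e)) ∂Q =
      ∫⁻ e, ⨆ i, G i * ENNReal.ofReal (Real.exp (-(2 * x i e))) ∂Q := by
    rw [← hS.lintegral_comp (by fun_prop)]
    simp only [hxS, mul_neg]
  have hcG : ⨆ i, G i * ENNReal.ofReal (Real.exp (2 * c i)) ≤
      ∫⁻ e, ⨆ i, G i * ENNReal.ofReal (Real.exp (2 * |x i e|)) ∂Q := by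
    refine iSup_le fun i => ?_
    calc G i * ENNReal.ofReal (Real.exp (2 * c i))
        ≤ G i * ∫⁻ e, ENNReal.ofReal (Real.exp (2 * |x i e|)) ∂Q := by gcongr; exact hc i
      _ = ∫⁻ e, G i * ENNReal.ofReal (Real.exp (2 * |x i e|)) ∂Q :=
          (lintegral_const_mul _ (by fun_prop)).symm
      _ ≤ _ := lintegral_mono fun e =>
          le_iSup (fun i => G i * ENNReal.ofReal (Real.exp (2 * |x i e|))) i
  have hpt : ∀ e, (⨆ i, G i * ENNReal.ofReal (Real.exp (2 * |x i e|))) +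
      (⨆ i, G i * ENNReal.ofReal (Real.exp (-2 * |x i e|))) ≤
      (⨆ i, G i * ENNReal.ofReal (Real.exp (2 * x i e))) +
      (⨆ i, G i * ENNReal.ofReal (Real.exp (-(2 * x i e)))) := by
    intro e
    refine ENNReal.iSup_add_iSup_le fun i j => ?_
    have key : ∀ s : ℝ, (s = 1 ∨ s = -1) →
        G j * ENNReal.ofReal (Real.exp (-2 * |x j e|)) ≤
          G j * ENNReal.ofReal (Real.exp (s * (2 * x j e))) := by
      intro s hs
      gcongr G j * ENNReal.ofReal (Real.exp ?_)
      rcases hs with rfl | rfl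
      · linarith [neg_abs_le (x j e)]
      · linarith [le_abs_self (x j e)]
    rcases le_total 0 (x i e) with h | h
    · rw [abs_of_nonneg h]
      refine add_le_add (le_iSup (fun i => G i * ENNReal.ofReal (Real.exp (2 * x i e))) i) ?_
      refine (key (-1) (Or.inr rfl)).trans ?_
      rw [neg_one_mul]
      exact le_iSup (fun j => G j * ENNReal.ofReal (Real.exp (-(2 * x j e)))) j
    · rw [abs_of_nonpos h, mul_neg, add_comm]
      refine add_le_add ((key 1 (Or.inl rfl)).trans ?_)
        (le_iSup (fun i => G i * ENNReal.ofReal (Real.exp (-(2 * x i e)))) i)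
      rw [one_mul]
      exact le_iSup (fun j => G j * ENNReal.ofReal (Real.exp (2 * x j e))) j
  have htwo : 2 * ∫⁻ e, ⨆ i, G i * ENNReal.ofReal (Real.exp (c i - |x i e|)) ∂Q ≤
      2 * ∫⁻ e, ⨆ i, G i * ENNReal.ofReal (Real.exp (2 * x i e)) ∂Q := by
    calc 2 * ∫⁻ e, ⨆ i, G i * ENNReal.ofReal (Real.exp (c i - |x i e|)) ∂Q
        = ∫⁻ e, ⨆ i, G i * (2 * ENNReal.ofReal (Real.exp (c i - |x i e|))) ∂Q := by
          rw [← lintegral_const_mul _ (by fun_prop)]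
          simp only [ENNReal.mul_iSup, mul_left_comm]
      _ ≤ ∫⁻ e, ((⨆ i, G i * ENNReal.ofReal (Real.exp (2 * c i))) +
            ⨆ i, G i * ENNReal.ofReal (Real.exp (-2 * |x i e|))) ∂Q := by
          refine lintegral_mono fun e => iSup_le fun i => ?_
          calc G i * (2 * ENNReal.ofReal (Real.exp (c i - |x i e|)))
              ≤ G i * (ENNReal.ofReal (Real.exp (2 * c i)) +
                ENNReal.ofReal (Real.exp (-2 * |x i e|))) := by
                gcongr
                rw [← ENNReal.ofReal_add (by positivity) (by positivity),
                  show (2 : ℝ≥0∞) = ENNReal.ofReal 2 by simp, ← ENNReal.ofReal_mul (by norm_num)]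
                exact ENNReal.ofReal_le_ofReal (two_mul_exp_sub_le _ _)
            _ ≤ _ := by
                rw [mul_add]
                exact add_le_add (le_iSup (fun i => G i * ENNReal.ofReal (Real.exp (2 * c i))) i)
                  (le_iSup (fun i => G i * ENNReal.ofReal (Real.exp (-2 * |x i e|))) i)
      _ ≤ ∫⁻ e, (⨆ i, G i * ENNReal.ofReal (Real.exp (2 * |x i e|))) +
            ⨆ i, G i * ENNReal.ofReal (Real.exp (-2 * |x i e|)) ∂Q := by
          rw [lintegral_add_left measurable_const, lintegral_const, measure_univ, mul_one,
            lintegral_add_left (by fun_prop)]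
          gcongr
      _ ≤ _ := lintegral_mono hpt
      _ = _ := by
          rw [lintegral_add_left (by fun_prop), ← hsymm, two_mul]
  exact (ENNReal.mul_le_mul_iff_right two_ne_zero ofNat_ne_top).mp htwo

end Comparison

section Moments

open ENNReal

lemma integrable_of_lintegral_pow_four_lt_top {Ω : Type*} [MeasurableSpace Ω] {μ : Measure Ω}
    [IsProbabilityMeasure μ] {f : Ω → ℝ} (hf : Measurable f)
    (h : ∫⁻ ω, ENNReal.ofReal (f ω ^ 4) ∂μ < ∞) :
    Integrable f μ ∧ Integrable (fun ω => f ω ^ 2) μ ∧ Integrable (fun ω => f ω ^ 4) μ := by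
  have h4 : Integrable (fun ω => f ω ^ 4) μ := by
    refine ⟨by fun_prop, ?_⟩
    rwa [hasFiniteIntegral_iff_ofReal (Filter.Eventually.of_forall fun ω => by positivity)]
  have h1 := (integrable_const (1 : ℝ)).add h4
  refine ⟨h1.mono' (by fun_prop) ?_, h1.mono' (by fun_prop) ?_, h4⟩
  · refine Filter.Eventually.of_forall fun ω => ?_
    simp only [Pi.add_apply, Real.norm_eq_abs]
    rw [abs_le]
    constructor <;> nlinarith [sq_nonneg (f ω ^ 2 - 1 / 2), sq_nonneg (f ω - 1 / 2),
      sq_nonneg (f ω + 1 / 2)]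
  · refine Filter.Eventually.of_forall fun ω => ?_
    simp only [Pi.add_apply, Real.norm_eq_abs, abs_pow, sq_abs]
    nlinarith [sq_nonneg (f ω ^ 2 - 1 / 2)]

variable {P : Measure ℝ} [IsProbabilityMeasure P] {a : ℝ}

/-- The constant in the fourth moment bound. -/
noncomputable def momentConst (a : ℝ) : ℝ := 48 * Real.exp (a ^ 2 / 2)

lemma momentConst_pos (a : ℝ) : 0 < momentConst a := by unfold momentConst; positivity

lemma pow_four_le_exp (y : ℝ) : y ^ 4 ≤ 24 * (Real.exp y + Real.exp (-y)) := by
  have h := Real.pow_div_factorial_le_exp |y| (abs_nonneg y) 4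
  have h2 : |y| ^ 4 = y ^ 4 := by rw [show 4 = 2 * 2 by norm_num, pow_mul, sq_abs, ← pow_mul]
  have h3 : Real.exp |y| ≤ Real.exp y + Real.exp (-y) := by
    rcases abs_choice y with h | h <;> rw [h] <;> linarith [Real.exp_pos y, Real.exp_pos (-y)]
  rw [h2, show ((Nat.factorial 4 : ℕ) : ℝ) = 24 by norm_num [Nat.factorial]] at h
  linarith

lemma dotProduct_self_nonneg {p : ℕ} (w : Fin p → ℝ) : 0 ≤ w ⬝ᵥ w :=
  Finset.sum_nonneg fun i _ => mul_self_nonneg (w i)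

lemma MGFBound.lintegral_pow_four_le (h : MGFBound P a) {p : ℕ} (w : Fin p → ℝ) :
    ∫⁻ b, ENNReal.ofReal ((w ⬝ᵥ b) ^ 4) ∂(Measure.pi fun _ => P) ≤
      ENNReal.ofReal (momentConst a * (w ⬝ᵥ w) ^ 2) := by
  have hw0 : 0 ≤ w ⬝ᵥ w := dotProduct_self_nonneg w
  rcases hw0.eq_or_lt with hw | hw
  · have : w = 0 := dotProduct_self_eq_zero.mp hw.symm
    simp [this]
  set s := √(w ⬝ᵥ w)
  have hs : 0 < s := Real.sqrt_pos.mpr hw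
  have hs2 : s ^ 2 = w ⬝ᵥ w := Real.sq_sqrt hw0
  set w' := s⁻¹ • w
  have hw' : w' ⬝ᵥ w' = 1 := by
    simp only [w', smul_dotProduct, dotProduct_smul, smul_eq_mul, ← hs2]
    field_simp
  have hww : w = s • w' := by simp only [w']; rw [smul_inv_smul₀ hs.ne']
  have hbd : ∀ v : Fin p → ℝ, v ⬝ᵥ v = 1 →
      ∫⁻ b, ENNReal.ofReal (Real.exp (v ⬝ᵥ b)) ∂(Measure.pi fun _ => P) ≤
        ENNReal.ofReal (Real.exp (a ^ 2 / 2)) := fun v hv => by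
    have := h.lintegral_pi_le v
    rwa [hv, mul_one] at this
  have hm : ∀ v : Fin p → ℝ, Measurable fun b : Fin p → ℝ => v ⬝ᵥ b := fun v => by
    unfold dotProduct; fun_prop
  have hm' := hm w'
  have hm'' := hm (-w')
  calc ∫⁻ b, ENNReal.ofReal ((w ⬝ᵥ b) ^ 4) ∂(Measure.pi fun _ => P)
      ≤ ∫⁻ b, ENNReal.ofReal (s ^ 4 * 24) * (ENNReal.ofReal (Real.exp (w' ⬝ᵥ b)) +
          ENNReal.ofReal (Real.exp ((-w') ⬝ᵥ b))) ∂(Measure.pi fun _ => P) := by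
        refine lintegral_mono fun b => ?_
        rw [← ENNReal.ofReal_add (by positivity) (by positivity),
          ← ENNReal.ofReal_mul (by positivity)]
        apply ENNReal.ofReal_le_ofReal
        rw [hww, smul_dotProduct, smul_eq_mul, mul_pow, neg_dotProduct, mul_assoc]
        gcongr
        exact pow_four_le_exp _
    _ ≤ ENNReal.ofReal (s ^ 4 * 24) * (ENNReal.ofReal (Real.exp (a ^ 2 / 2)) +
          ENNReal.ofReal (Real.exp (a ^ 2 / 2))) := by
        rw [lintegral_const_mul _ (by fun_prop), lintegral_add_left (by fun_prop)]
        gcongr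
        · exact hbd _ hw'
        · exact hbd _ (by simpa using hw')
    _ = _ := by
        rw [← ENNReal.ofReal_add (by positivity) (by positivity),
          ← ENNReal.ofReal_mul (by positivity), momentConst, ← hs2]
        congr 1
        ring

variable {p₁ p₂ : ℕ}

lemma frobSq_eq_sum_dotProduct (M : Matrix (Fin p₁) (Fin p₂) ℝ) :
    frobSq M = ∑ i, M i ⬝ᵥ M i := by
  simp [frobSq, dotProduct, sq]

lemma measurable_bilin (M : Matrix (Fin p₁) (Fin p₂) ℝ) :
    Measurable fun q : (Fin p₁ → ℝ) × (Fin p₂ → ℝ) => q.1 ⬝ᵥ (M *ᵥ q.2) := by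
  unfold Matrix.mulVec dotProduct; fun_prop

lemma sq_dotProduct_mulVec_le (M : Matrix (Fin p₁) (Fin p₂) ℝ) (g : Fin p₂ → ℝ) :
    ((M *ᵥ g) ⬝ᵥ (M *ᵥ g)) ^ 2 ≤ frobSq M * ∑ i, (M i ⬝ᵥ M i)⁻¹ * (M i ⬝ᵥ g) ^ 4 := by
  rw [frobSq_eq_sum_dotProduct]
  refine Finset.sum_sq_le_sum_mul_sum_of_sq_le_mul _ (fun i _ => dotProduct_self_nonneg _)
    (fun i _ => mul_nonneg (inv_nonneg.mpr (dotProduct_self_nonneg _)) (by positivity))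
    fun i _ => le_of_eq ?_
  by_cases h : M i ⬝ᵥ M i = 0
  · have : M i = 0 := dotProduct_self_eq_zero.mp h
    simp [Matrix.mulVec, this]
  · rw [mul_inv_cancel_left₀ h]
    simp only [Matrix.mulVec]
    ring

lemma MGFBound.lintegral_bilin_pow_four_le (h : MGFBound P a) (M : Matrix (Fin p₁) (Fin p₂) ℝ) :
    ∫⁻ q, ENNReal.ofReal ((q.1 ⬝ᵥ (M *ᵥ q.2)) ^ 4) ∂(pairLaw P p₁ p₂) ≤
      ENNReal.ofReal (momentConst a ^ 2 * frobSq M ^ 2) := by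
  have hK := momentConst_pos a
  rw [lintegral_prod_symm _ ((measurable_bilin M).pow_const 4).ennreal_ofReal.aemeasurable]
  have hm : ∀ i, Measurable fun g : Fin p₂ → ℝ => M i ⬝ᵥ g := fun v => by
    unfold dotProduct; fun_prop
  calc _ ≤ ∫⁻ g, ∑ i, ENNReal.ofReal (momentConst a * frobSq M * (M i ⬝ᵥ M i)⁻¹) *
          ENNReal.ofReal ((M i ⬝ᵥ g) ^ 4) ∂(Measure.pi fun _ => P) := by
        refine lintegral_mono fun g => ?_
        simp only [dotProduct_comm _ (M *ᵥ g)]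
        refine (h.lintegral_pow_four_le _).trans ?_
        have hnn : ∀ i, 0 ≤ momentConst a * frobSq M * (M i ⬝ᵥ M i)⁻¹ := fun i =>
          mul_nonneg (mul_nonneg hK.le (frobSq_nonneg M)) (inv_nonneg.mpr (dotProduct_self_nonneg _))
        simp only [← ENNReal.ofReal_mul (hnn _)]
        rw [← ENNReal.ofReal_sum_of_nonneg fun i _ => mul_nonneg (hnn i) (by positivity)]
        apply ENNReal.ofReal_le_ofReal
        refine (mul_le_mul_of_nonneg_left (sq_dotProduct_mulVec_le M g) hK.le).trans_eq ?_
        rw [← mul_assoc, Finset.mul_sum]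
        simp only [mul_assoc]
    _ ≤ ∑ i, ENNReal.ofReal (momentConst a * frobSq M * (M i ⬝ᵥ M i)⁻¹) *
          ENNReal.ofReal (momentConst a * (M i ⬝ᵥ M i) ^ 2) := by
        rw [lintegral_finsetSum _ fun i _ => by
          have := hm i
          fun_prop]
        refine Finset.sum_le_sum fun i _ => ?_
        have := hm i
        rw [lintegral_const_mul _ (by fun_prop)]
        gcongr
        exact h.lintegral_pow_four_le _
    _ = ENNReal.ofReal (momentConst a ^ 2 * frobSq M ^ 2) := by
        have hnn : ∀ i, 0 ≤ momentConst a * frobSq M * (M i ⬝ᵥ M i)⁻¹ := fun i =>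
          mul_nonneg (mul_nonneg hK.le (frobSq_nonneg M)) (inv_nonneg.mpr (dotProduct_self_nonneg _))
        simp only [← ENNReal.ofReal_mul (hnn _)]
        rw [← ENNReal.ofReal_sum_of_nonneg fun i _ => mul_nonneg (hnn i) (by positivity)]
        congr 1
        have : ∀ i, momentConst a * frobSq M * (M i ⬝ᵥ M i)⁻¹ * (momentConst a * (M i ⬝ᵥ M i) ^ 2) =
            momentConst a ^ 2 * frobSq M * (M i ⬝ᵥ M i) := fun i => by
          by_cases h0 : M i ⬝ᵥ M i = 0
          · simp [h0]
          · field_simp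
        simp only [this]
        rw [← Finset.mul_sum, ← frobSq_eq_sum_dotProduct]
        ring

lemma integral_sq_dotProduct (hm : ∫ x, x ∂P = 0) (hL : MemLp id 2 P) (hv : Var[id; P] = 1)
    {p : ℕ} (w : Fin p → ℝ) : ∫ b, (w ⬝ᵥ b) ^ 2 ∂(Measure.pi fun _ => P) = w ⬝ᵥ w := by
  have hLi : ∀ i, MemLp (fun x : ℝ => w i * x) 2 P := fun i => hL.const_mul (w i)
  have h1 := variance_sum_pi (μ := fun _ : Fin p => P) (X := fun i x => w i * x) hLi
  have h2 : (∑ i, fun b : Fin p → ℝ => w i * b i) = fun b => w ⬝ᵥ b := by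
    ext b; simp [dotProduct]
  have hmeas : Measurable fun b : Fin p → ℝ => w ⬝ᵥ b := by unfold dotProduct; fun_prop
  have h3 : ∫ b, w ⬝ᵥ b ∂(Measure.pi fun _ => P) = 0 := by
    simp only [dotProduct]
    rw [integral_finsetSum]
    · refine Finset.sum_eq_zero fun i _ => ?_
      have h0 : ∫ b : Fin p → ℝ, b i ∂(Measure.pi fun _ => P) = ∫ x, x ∂P :=
        integral_comp_eval (μ := fun _ => P) (f := id) hL.aestronglyMeasurable
      rw [integral_const_mul, h0, hm, mul_zero]
    · intro i _
      exact ((measurePreserving_eval (fun _ : Fin p => P) i).integrable_comp_of_integrable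
        (hL.integrable one_le_two)).const_mul _
  rw [h2, variance_eq_integral hmeas.aemeasurable, h3] at h1
  simp only [sub_zero] at h1
  rw [h1]
  have h4 : ∀ i, Var[fun x : ℝ => w i * x; P] = w i * w i := fun i => by
    rw [variance_const_mul, ← sq]
    have : Var[fun x : ℝ => x; P] = 1 := hv
    rw [this, mul_one]
  simp only [h4, dotProduct]

lemma MGFBound.integral_bilin_sq (h : MGFBound P a) (hm : ∫ x, x ∂P = 0) (hL : MemLp id 2 P)
    (hv : Var[id; P] = 1) (M : Matrix (Fin p₁) (Fin p₂) ℝ) :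
    ∫ q, (q.1 ⬝ᵥ (M *ᵥ q.2)) ^ 2 ∂(pairLaw P p₁ p₂) = frobSq M := by
  have hint := (integrable_of_lintegral_pow_four_lt_top (measurable_bilin M)
    ((h.lintegral_bilin_pow_four_le M).trans_lt ofReal_lt_top)).2.1
  rw [integral_prod_symm _ hint]
  have h1 : ∀ g : Fin p₂ → ℝ, ∫ b, (b ⬝ᵥ (M *ᵥ g)) ^ 2 ∂(Measure.pi fun _ : Fin p₁ => P) =
      ∑ i, (M i ⬝ᵥ g) ^ 2 := fun g => by
    simp only [dotProduct_comm _ (M *ᵥ g)]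
    rw [integral_sq_dotProduct hm hL hv, dotProduct]
    simp only [Matrix.mulVec, ← sq]
  simp only [h1]
  rw [integral_finsetSum, frobSq_eq_sum_dotProduct]
  · exact Finset.sum_congr rfl fun i _ => integral_sq_dotProduct hm hL hv _
  · intro i _
    exact (integrable_of_lintegral_pow_four_lt_top (by unfold dotProduct; fun_prop)
      ((h.lintegral_pow_four_le (M i)).trans_lt ofReal_lt_top)).2.1

/-- Lower bound for the first absolute moment of `βᵀ M γ`. -/
lemma MGFBound.le_integral_abs_bilin (h : MGFBound P a) (hm : ∫ x, x ∂P = 0) (hL : MemLp id 2 P)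
    (hv : Var[id; P] = 1) {M : Matrix (Fin p₁) (Fin p₂) ℝ} (hM : frobSq M = 1) :
    3 / (8 * momentConst a) ≤ ∫ q, |q.1 ⬝ᵥ (M *ᵥ q.2)| ∂(pairLaw P p₁ p₂) := by
  have hK := momentConst_pos a
  obtain ⟨i1, i2, i4⟩ := integrable_of_lintegral_pow_four_lt_top (measurable_bilin M)
    ((h.lintegral_bilin_pow_four_le M).trans_lt ofReal_lt_top)
  have e2 := h.integral_bilin_sq hm hL hv M
  have e4 : ∫ q, (q.1 ⬝ᵥ (M *ᵥ q.2)) ^ 4 ∂(pairLaw P p₁ p₂) ≤ momentConst a ^ 2 := by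
    rw [integral_eq_lintegral_of_nonneg_ae (Filter.Eventually.of_forall fun q => by positivity)
      i4.aestronglyMeasurable]
    have := h.lintegral_bilin_pow_four_le M
    rw [hM] at this
    exact ENNReal.toReal_le_of_le_ofReal (by positivity) (by simpa using this)
  set L := 2 * momentConst a with hLdef
  have hLpos : 0 < L := by positivity
  have key : ∫ q, (q.1 ⬝ᵥ (M *ᵥ q.2)) ^ 2 ∂(pairLaw P p₁ p₂) ≤
      ∫ q, (L * |q.1 ⬝ᵥ (M *ᵥ q.2)| + (q.1 ⬝ᵥ (M *ᵥ q.2)) ^ 4 / L ^ 2) ∂(pairLaw P p₁ p₂) := by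
    refine integral_mono i2 ((i1.abs.const_mul _).add (i4.div_const _)) fun q => ?_
    dsimp only
    set y := q.1 ⬝ᵥ (M *ᵥ q.2)
    rw [← sq_abs y, show y ^ 4 = |y| ^ 4 by
      rw [show 4 = 2 * 2 by norm_num, pow_mul, pow_mul, sq_abs]]
    rcases le_total |y| L with hy | hy
    · have : 0 ≤ |y| ^ 4 / L ^ 2 := by positivity
      nlinarith [abs_nonneg y]
    · have h1 : |y| ^ 2 ≤ |y| ^ 4 / L ^ 2 := by
        rw [le_div_iff₀ (by positivity)]
        have : L ^ 2 ≤ |y| ^ 2 := pow_le_pow_left₀ hLpos.le hy 2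
        nlinarith [sq_nonneg |y|]
      have : 0 ≤ L * |y| := by positivity
      linarith
  rw [integral_add (i1.abs.const_mul _) (i4.div_const _), integral_const_mul, integral_div, e2,
    hM] at key
  have h5 : (∫ q, (q.1 ⬝ᵥ (M *ᵥ q.2)) ^ 4 ∂(pairLaw P p₁ p₂)) / L ^ 2 ≤ 1 / 4 := by
    rw [div_le_iff₀ (by positivity)]
    calc _ ≤ _ := e4
      _ = _ := by rw [hLdef]; ring
  rw [div_le_iff₀ (by positivity)]
  linarith

end Moments

section Nets

open Metric ENNReal Module

variable {E F : Type*} [NormedAddCommGroup E] [InnerProductSpace ℝ E] [FiniteDimensional ℝ E]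
  [NormedAddCommGroup F] [InnerProductSpace ℝ F] [FiniteDimensional ℝ F]

open scoped Function in
/-- Volume bound for the cardinality of a `1/4`-separated subset of the unit ball. -/
lemma card_le_of_separated (s : Finset E) (hs : ∀ c ∈ s, ‖c‖ ≤ 1)
    (h : ∀ c ∈ s, ∀ d ∈ s, c ≠ d → 1 / 4 ≤ ‖c - d‖) : s.card ≤ 9 ^ finrank ℝ E := by
  borelize E
  let μ : Measure E := Measure.addHaar
  have D : Set.Pairwise (s : Set E) (Disjoint on fun c => ball (c : E) (1 / 8)) := by
    rintro c hc d hd hcd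
    apply ball_disjoint_ball
    rw [dist_eq_norm]
    have := h c hc d hd hcd
    linarith
  have hsub : ⋃ c ∈ s, ball (c : E) (1 / 8) ⊆ ball (0 : E) (9 / 8) := by
    refine Set.iUnion₂_subset fun x hx => ball_subset_ball' ?_
    rw [dist_zero_right]
    linarith [hs x hx]
  have I : (s.card : ℝ≥0∞) * ENNReal.ofReal ((1 / 8) ^ finrank ℝ E) * μ (ball 0 1) ≤
      ENNReal.ofReal ((9 / 8) ^ finrank ℝ E) * μ (ball 0 1) :=
    calc _ = μ (⋃ c ∈ s, ball (c : E) (1 / 8)) := by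
          rw [measure_biUnion_finset D fun c _ => measurableSet_ball]
          simp only [μ.addHaar_ball_of_pos _ (show (0 : ℝ) < 1 / 8 by norm_num)]
          simp only [Finset.sum_const, nsmul_eq_mul, mul_assoc]
      _ ≤ μ (ball (0 : E) (9 / 8)) := measure_mono hsub
      _ = _ := by simp only [μ.addHaar_ball_of_pos _ (show (0 : ℝ) < 9 / 8 by norm_num)]
  have J := (ENNReal.mul_le_mul_iff_left (measure_ball_pos _ _ zero_lt_one).ne'
    measure_ball_lt_top.ne).1 I
  have K := ENNReal.toReal_le_of_le_ofReal (by positivity) J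
  rw [ENNReal.toReal_mul, ENNReal.toReal_natCast, ENNReal.toReal_ofReal (by positivity), div_pow,
    div_pow, one_pow, mul_one_div] at K
  have K' := (div_le_div_iff_of_pos_right (by positivity)).mp K
  exact_mod_cast K'

variable (E) in
/-- A `1/4`-net of the unit ball. -/
lemma exists_net : ∃ s : Finset E, s.card ≤ 9 ^ finrank ℝ E ∧ (∀ c ∈ s, ‖c‖ ≤ 1) ∧
    ∀ x : E, ‖x‖ ≤ 1 → ∃ c ∈ s, ‖x - c‖ ≤ 1 / 4 := by
  classical
  let Sep : Finset E → Prop := fun s =>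
    (∀ c ∈ s, ‖c‖ ≤ 1) ∧ ∀ c ∈ s, ∀ d ∈ s, c ≠ d → 1 / 4 ≤ ‖c - d‖
  have hne : ∃ s : Finset E, Sep s ∧ s.card = 0 := ⟨∅, by simp [Sep], rfl⟩
  obtain ⟨s, hs, hcard⟩ := Nat.findGreatest_spec
    (P := fun k => ∃ s : Finset E, Sep s ∧ s.card = k) (Nat.zero_le (9 ^ finrank ℝ E)) hne
  refine ⟨s, card_le_of_separated s hs.1 hs.2, hs.1, fun x hx => ?_⟩
  by_contra! hcon
  have hxs : x ∉ s := fun hmem => by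
    have := hcon x hmem
    norm_num at this
  have hsep : Sep (insert x s) := by
    refine ⟨fun c hc => ?_, fun c hc d hd hcd => ?_⟩
    · rcases Finset.mem_insert.mp hc with rfl | hc
      exacts [hx, hs.1 c hc]
    · rcases Finset.mem_insert.mp hc with rfl | hc' <;> rcases Finset.mem_insert.mp hd with rfl | hd'
      · exact absurd rfl hcd
      · exact (hcon d hd').le
      · rw [norm_sub_rev]; exact (hcon c hc').le
      · exact hs.2 c hc' d hd' hcd
  have hle := Nat.le_findGreatest (P := fun k => ∃ s : Finset E, Sep s ∧ s.card = k)
    (card_le_of_separated _ hsep.1 hsep.2) ⟨_, hsep, rfl⟩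
  rw [Finset.card_insert_of_notMem hxs] at hle
  omega

omit [FiniteDimensional ℝ E] [FiniteDimensional ℝ F] in
lemma norm_le_two_mul_of_net {s : Finset F} {t : Finset E} (hs1 : ∀ c ∈ s, ‖c‖ ≤ 1)
    (hs : ∀ x : F, ‖x‖ ≤ 1 → ∃ c ∈ s, ‖x - c‖ ≤ 1 / 4)
    (ht : ∀ x : E, ‖x‖ ≤ 1 → ∃ c ∈ t, ‖x - c‖ ≤ 1 / 4) (L : E →L[ℝ] F) {T : ℝ}
    (hT : ∀ c ∈ s, ∀ d ∈ t, inner ℝ c (L d) ≤ T) : ‖L‖ ≤ 2 * T := by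
  have key : ∀ y : F, ‖y‖ ≤ 1 → ∀ x : E, ‖x‖ ≤ 1 → inner ℝ y (L x) ≤ T + ‖L‖ / 2 := by
    intro y hy x hx
    obtain ⟨c, hc, hyc⟩ := hs y hy
    obtain ⟨d, hd, hxd⟩ := ht x hx
    have h1 : inner ℝ y (L x) = inner ℝ c (L d) + inner ℝ (y - c) (L x) + inner ℝ c (L (x - d)) := by
      rw [inner_sub_left, map_sub, inner_sub_right]; ring
    have h2 : inner ℝ (y - c) (L x) ≤ 1 / 4 * (‖L‖ * 1) :=
      (real_inner_le_norm _ _).trans (mul_le_mul hyc (L.le_opNorm_of_le hx)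
        (norm_nonneg _) (by norm_num))
    have h3 : inner ℝ c (L (x - d)) ≤ 1 * (‖L‖ * (1 / 4)) :=
      (real_inner_le_norm _ _).trans (mul_le_mul (hs1 c hc) (L.le_opNorm_of_le hxd)
        (norm_nonneg _) (by norm_num))
    linarith [hT c hc d hd]
  have h0 : 0 ≤ T + ‖L‖ / 2 := by simpa using key 0 (by simp) 0 (by simp)
  have hL : ‖L‖ ≤ T + ‖L‖ / 2 := by
    refine L.opNorm_le_of_unit_norm h0 fun x hx => ?_
    rcases eq_or_ne (L x) 0 with h | h
    · rwa [h, norm_zero]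
    · have hn : ‖L x‖ ≠ 0 := norm_ne_zero_iff.mpr h
      have := key (‖L x‖⁻¹ • L x) (by rw [norm_smul, norm_inv, norm_norm, inv_mul_cancel₀ hn]) x hx.le
      rw [inner_smul_left, real_inner_self_eq_norm_sq] at this
      simp only [conj_trivial] at this
      rwa [sq, inv_mul_cancel_left₀ hn] at this
  linarith

omit [FiniteDimensional ℝ E] [FiniteDimensional ℝ F] in
lemma exp_norm_le_sum_net {s : Finset F} {t : Finset E} (hs1 : ∀ c ∈ s, ‖c‖ ≤ 1)
    (hs : ∀ x : F, ‖x‖ ≤ 1 → ∃ c ∈ s, ‖x - c‖ ≤ 1 / 4)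
    (ht : ∀ x : E, ‖x‖ ≤ 1 → ∃ c ∈ t, ‖x - c‖ ≤ 1 / 4) (L : E →L[ℝ] F) {l : ℝ} (hl : 0 ≤ l) :
    ENNReal.ofReal (Real.exp (l * ‖L‖)) ≤
      ∑ q ∈ s ×ˢ t, ENNReal.ofReal (Real.exp (2 * l * inner ℝ q.1 (L q.2))) := by
  obtain ⟨c0, hc0, -⟩ := hs 0 (by simp)
  obtain ⟨d0, hd0, -⟩ := ht 0 (by simp)
  obtain ⟨q, hq, hmax⟩ := (s ×ˢ t).exists_max_image (fun q => inner ℝ q.1 (L q.2))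
    ⟨(c0, d0), Finset.mk_mem_product hc0 hd0⟩
  have h := norm_le_two_mul_of_net hs1 hs ht L (T := inner ℝ q.1 (L q.2))
    fun c hc d hd => hmax (c, d) (Finset.mk_mem_product hc hd)
  refine le_trans ?_ (Finset.single_le_sum (f := fun q : F × E =>
    ENNReal.ofReal (Real.exp (2 * l * inner ℝ q.1 (L q.2)))) (fun _ _ => zero_le) hq)
  apply ENNReal.ofReal_le_ofReal
  rw [Real.exp_le_exp]
  nlinarith

end Nets

section NormMGF

open ENNReal

variable {P : Measure ℝ} [IsProbabilityMeasure P] {a : ℝ} {p₁ p₂ n : ℕ}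

lemma inner_toOp_dual (β : Fin n → Fin p₁ → ℝ) (γ : Fin n → Fin p₂ → ℝ) (w : Fin n → ℝ)
    (u : EuclideanSpace ℝ (Fin p₁)) (v : EuclideanSpace ℝ (Fin p₂)) :
    inner ℝ u (toOp (dual β γ w) v) = ∑ i, w i * ((⇑u ⬝ᵥ β i) * (⇑v ⬝ᵥ γ i)) := by
  rw [toOp_apply, dual, EuclideanSpace.inner_eq_star_dotProduct, Matrix.sum_mulVec,
    sum_dotProduct]
  refine Finset.sum_congr rfl fun i _ => ?_
  rw [Matrix.smul_mulVec, Matrix.vecMulVec_mulVec]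
  simp only [star_trivial, smul_dotProduct, op_smul_eq_smul, smul_eq_mul]
  rw [dotProduct_comm (γ i), dotProduct_comm (β i)]
  ring

lemma nine_pow_le_exp (p : ℕ) : (9 : ℝ) ^ p ≤ Real.exp (11 / 5 * p) := by
  have h : (9 : ℝ) ≤ Real.exp (11 / 5) := by
    have h1 := Real.exp_one_gt_d9
    have h2 : (9 : ℝ) ^ 5 ≤ Real.exp (11 / 5) ^ 5 := by
      rw [← Real.exp_nat_mul]
      have h3 : Real.exp ((5 : ℕ) * (11 / 5)) = Real.exp 1 ^ 11 := by
        rw [← Real.exp_nat_mul]; norm_num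
      rw [h3]
      calc (9 : ℝ) ^ 5 ≤ 2.7182818283 ^ 11 := by norm_num
        _ ≤ _ := by gcongr
    exact le_of_pow_le_pow_left₀ (by norm_num) (Real.exp_pos _).le h2
  rw [mul_comm, Real.exp_nat_mul]
  gcongr

lemma dotProduct_self_le_one {p : ℕ} {u : EuclideanSpace ℝ (Fin p)} (hu : ‖u‖ ≤ 1) :
    (⇑u : Fin p → ℝ) ⬝ᵥ ⇑u ≤ 1 := by
  have : (⇑u : Fin p → ℝ) ⬝ᵥ ⇑u = ‖u‖ ^ 2 := by
    rw [EuclideanSpace.real_norm_sq_eq, dotProduct]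
    simp only [sq]
  rw [this]
  exact pow_le_one₀ (norm_nonneg _) hu

lemma continuous_dual_design (w : Fin n → ℝ) :
    Continuous fun d : Fin n → (Fin p₁ → ℝ) × (Fin p₂ → ℝ) =>
      dual (fun i => (d i).1) (fun i => (d i).2) w := by
  unfold dual Matrix.vecMulVec
  fun_prop

/-- Exponential moments of the spectral norm of `𝒳*(w)`. -/
theorem MGFBound.lintegral_exp_specNorm_le (h : MGFBound P a) {w : Fin n → ℝ} {l : ℝ} (hl : 0 ≤ l)
    (hw : ∀ i, 2 * l * |w i| * a ^ 2 ≤ 4 / 5) :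
    ∫⁻ d, ENNReal.ofReal (Real.exp (l * specNorm (dual (fun i => (d i).1) (fun i => (d i).2) w)))
        ∂(designLaw P p₁ p₂ n) ≤
      ENNReal.ofReal (Real.exp (11 / 5 * (p₁ + p₂) + 16 / 5 * l ^ 2 * a ^ 4 * ∑ i, w i ^ 2)) := by
  obtain ⟨s, hsc, hs1, hs⟩ := exists_net (EuclideanSpace ℝ (Fin p₁))
  obtain ⟨t, htc, ht1, ht⟩ := exists_net (EuclideanSpace ℝ (Fin p₂))
  rw [finrank_euclideanSpace_fin] at hsc htc
  have hcard : ((s ×ˢ t).card : ℝ) ≤ Real.exp (11 / 5 * (p₁ + p₂)) := by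
    have h1 : ((s ×ˢ t).card : ℝ) ≤ (9 : ℝ) ^ (p₁ + p₂) := by
      rw [Finset.card_product, pow_add]
      exact_mod_cast Nat.mul_le_mul hsc htc
    have h2 := nine_pow_le_exp (p₁ + p₂)
    push_cast at h2
    exact h1.trans h2
  have hrew : ∀ (d : Fin n → (Fin p₁ → ℝ) × (Fin p₂ → ℝ))
      (q : EuclideanSpace ℝ (Fin p₁) × EuclideanSpace ℝ (Fin p₂)),
      2 * l * inner ℝ q.1 (toOp (dual (fun i => (d i).1) (fun i => (d i).2) w) q.2) =
        ∑ i, (2 * l * w i) * ((⇑q.1 ⬝ᵥ (d i).1) * (⇑q.2 ⬝ᵥ (d i).2)) := fun d q => by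
    rw [inner_toOp_dual, Finset.mul_sum]
    simp only [mul_assoc]
  calc _ ≤ ∫⁻ d, ∑ q ∈ s ×ˢ t, ENNReal.ofReal (Real.exp
          (∑ i, (2 * l * w i) * ((⇑q.1 ⬝ᵥ (d i).1) * (⇑q.2 ⬝ᵥ (d i).2))))
          ∂(designLaw P p₁ p₂ n) := by
        refine lintegral_mono fun d => ?_
        have := exp_norm_le_sum_net hs1 hs ht
          (toOp (dual (fun i => (d i).1) (fun i => (d i).2) w)) hl
        simp only [hrew, ← specNorm_eq] at this
        exact this
    _ = ∑ q ∈ s ×ˢ t, ∫⁻ d, ENNReal.ofReal (Real.exp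
          (∑ i, (2 * l * w i) * ((⇑q.1 ⬝ᵥ (d i).1) * (⇑q.2 ⬝ᵥ (d i).2))))
          ∂(designLaw P p₁ p₂ n) := by
        rw [lintegral_finsetSum]
        intro q _
        unfold dotProduct
        fun_prop
    _ ≤ ∑ q ∈ s ×ˢ t,
          ENNReal.ofReal (Real.exp (4 / 5 * a ^ 4 * ∑ i, (2 * l * w i) ^ 2)) := by
        refine Finset.sum_le_sum fun q hq => ?_
        rw [Finset.mem_product] at hq
        refine h.lintegral_designLaw_le (dotProduct_self_le_one (hs1 _ hq.1))
          (dotProduct_self_le_one (ht1 _ hq.2)) fun i => ?_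
        rw [abs_mul, abs_of_nonneg (by positivity : 0 ≤ 2 * l)]
        exact hw i
    _ = ENNReal.ofReal ((s ×ˢ t).card *
          Real.exp (4 / 5 * a ^ 4 * ∑ i, (2 * l * w i) ^ 2)) := by
        rw [Finset.sum_const, nsmul_eq_mul, ENNReal.ofReal_mul (Nat.cast_nonneg _),
          ENNReal.ofReal_natCast]
    _ ≤ _ := by
        apply ENNReal.ofReal_le_ofReal
        rw [Real.exp_add]
        have : 4 / 5 * a ^ 4 * ∑ i, (2 * l * w i) ^ 2 =
            16 / 5 * l ^ 2 * a ^ 4 * ∑ i, w i ^ 2 := by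
          simp only [mul_pow, ← Finset.mul_sum]
          ring
        rw [this]
        gcongr

/-- Chernoff bound for the spectral norm of `𝒳*(w)`. -/
lemma MGFBound.designLaw_specNorm_ge_le (h : MGFBound P a) {w : Fin n → ℝ} {l R : ℝ} (hl : 0 ≤ l)
    (hw : ∀ i, 2 * l * |w i| * a ^ 2 ≤ 4 / 5) :
    designLaw P p₁ p₂ n
        {d | R ≤ specNorm (dual (fun i => (d i).1) (fun i => (d i).2) w)} ≤
      ENNReal.ofReal
        (Real.exp (11 / 5 * (p₁ + p₂) + 16 / 5 * l ^ 2 * a ^ 4 * ∑ i, w i ^ 2 - l * R)) := by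
  have hm : Measurable fun d : Fin n → (Fin p₁ → ℝ) × (Fin p₂ → ℝ) =>
      ENNReal.ofReal (Real.exp (l * specNorm (dual (fun i => (d i).1) (fun i => (d i).2) w))) :=
    (Real.continuous_exp.comp (continuous_const.mul
      (continuous_specNorm.comp (continuous_dual_design w)))).measurable.ennreal_ofReal
  have h1 := mul_meas_ge_le_lintegral (μ := designLaw P p₁ p₂ n) hm
    (ENNReal.ofReal (Real.exp (l * R)))
  have h2 := h1.trans (h.lintegral_exp_specNorm_le hl hw)
  rw [Real.exp_sub, ENNReal.ofReal_div_of_pos (Real.exp_pos _),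
    ENNReal.le_div_iff_mul_le (Or.inl (by simp [Real.exp_pos])) (Or.inl ofReal_ne_top), mul_comm]
  refine le_trans ?_ h2
  gcongr with d
  intro hd
  exact ENNReal.ofReal_le_ofReal (Real.exp_le_exp.mpr (mul_le_mul_of_nonneg_left hd hl))

end NormMGF

section DesignBounds

open ENNReal

variable {P : Measure ℝ} [IsProbabilityMeasure P] {a : ℝ} {p₁ p₂ n r : ℕ}

lemma IsSymmetric.measurePreserving_neg_pairLaw (hs : IsSymmetric P) :
    MeasurePreserving (fun q : (Fin p₁ → ℝ) × (Fin p₂ → ℝ) => (-q.1, q.2))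
      (pairLaw P p₁ p₂) (pairLaw P p₁ p₂) := by
  have h1 : MeasurePreserving (fun (b : Fin p₁ → ℝ) i => -b i) (Measure.pi fun _ => P)
      (Measure.pi fun _ => P) :=
    measurePreserving_pi (fun _ => P) (fun _ => P) fun _ => hs.measurePreserving_neg
  exact h1.prod (MeasurePreserving.id _)

/-- The unit sphere of the cone of matrices that are nearly of rank `r`. -/
def coneSphere (p₁ p₂ r : ℕ) : Set (Matrix (Fin p₁) (Fin p₂) ℝ) :=
  {M | frobSq M = 1 ∧ nuclearNorm M ≤ 4 * √r}

lemma frobSq_smul (t : ℝ) (M : Matrix (Fin p₁) (Fin p₂) ℝ) :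
    frobSq (t • M) = t ^ 2 * frobSq M := by
  simp [frobSq, mul_pow, Finset.mul_sum]

lemma nuclearNorm_smul_le {t : ℝ} (ht : 0 ≤ t) (M : Matrix (Fin p₁) (Fin p₂) ℝ) :
    nuclearNorm (t • M) ≤ t * nuclearNorm M := by
  obtain ⟨B, hB, hM⟩ := exists_hs_eq_nuclearNorm (t • M)
  rw [← hM]
  have : hs B (toOp (t • M)) = t * hs B (toOp M) := by
    rw [hs_eq_sum (rightSingularBasis M), hs_eq_sum (rightSingularBasis M), Finset.mul_sum]
    simp [inner_smul_right]
  rw [this]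
  exact mul_le_mul_of_nonneg_left (hs_le_nuclearNorm hB M) ht

lemma ropMap_smul (β : Fin n → Fin p₁ → ℝ) (γ : Fin n → Fin p₂ → ℝ) (t : ℝ)
    (M : Matrix (Fin p₁) (Fin p₂) ℝ) : ropMap β γ (t • M) = t • ropMap β γ M := by
  ext i
  simp [ropMap, Matrix.smul_mulVec]

lemma exists_coneSphere_of_not_coneBound {c : ℝ} {β : Fin n → Fin p₁ → ℝ}
    {γ : Fin n → Fin p₂ → ℝ} (h : ¬ConeBound c r β γ) :
    ∃ M ∈ coneSphere p₁ p₂ r, ∑ i, |ropMap β γ M i| < c * n := by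
  unfold ConeBound at h
  push Not at h
  obtain ⟨M, hM, hlt⟩ := h
  have hf : 0 < √(frobSq M) := by
    rcases (Real.sqrt_nonneg (frobSq M)).eq_or_lt with h0 | h0
    · rw [← h0, mul_zero] at hlt
      exact absurd hlt (not_lt.mpr (by positivity))
    · exact h0
  have hf2 := Real.sq_sqrt (frobSq_nonneg M)
  set f := √(frobSq M)
  refine ⟨f⁻¹ • M, ⟨?_, ?_⟩, ?_⟩
  · rw [frobSq_smul, ← hf2]
    field_simp
  · refine (nuclearNorm_smul_le (by positivity) M).trans ?_
    rw [inv_mul_le_iff₀ hf]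
    linarith
  · rw [ropMap_smul]
    simp only [Pi.smul_apply, smul_eq_mul, abs_mul, ← Finset.mul_sum]
    rw [abs_of_pos (by positivity), inv_mul_lt_iff₀ hf]
    linarith

/-- Markov's inequality for the comparison process on the cone. -/
lemma MGFBound.designLaw_not_coneBound_le_exp (h : MGFBound P a) (hs : IsSymmetric P)
    (hL : MemLp id 2 P) (hv : Var[id; P] = 1) {l c : ℝ} (hl : 0 ≤ l)
    (hc : c ≤ 3 / (8 * momentConst a)) (hla : 16 * l * √r * a ^ 2 ≤ 4 / 5) :
    designLaw P p₁ p₂ n {d | ¬ConeBound (c / 2) r (fun i => (d i).1) (fun i => (d i).2)} ≤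
      ENNReal.ofReal (Real.exp (11 / 5 * (p₁ + p₂) + 16 / 5 * (8 * l * √r) ^ 2 * a ^ 4 * n -
        l * (c / 2 * n))) := by
  rcases isEmpty_or_nonempty (coneSphere p₁ p₂ r) with hT | hT
  · have : {d : Fin n → (Fin p₁ → ℝ) × (Fin p₂ → ℝ) |
        ¬ConeBound (c / 2) r (fun i => (d i).1) (fun i => (d i).2)} = ∅ := by
      ext d
      simp only [Set.mem_ofPred_eq, Set.mem_empty_iff_false, iff_false]
      intro hd
      obtain ⟨M, hM, -⟩ := exists_coneSphere_of_not_coneBound hd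
      exact hT.false ⟨M, hM⟩
    rw [this, measure_empty]
    exact zero_le
  have : SecondCountableTopology (Matrix (Fin p₁) (Fin p₂) ℝ) :=
    inferInstanceAs (SecondCountableTopology (Fin p₁ → Fin p₂ → ℝ))
  set M : ℕ → coneSphere p₁ p₂ r := TopologicalSpace.denseSeq _ with hMdef
  set x : ℕ → (Fin p₁ → ℝ) × (Fin p₂ → ℝ) → ℝ := fun k q => l * (q.1 ⬝ᵥ ((M k).1 *ᵥ q.2)) with hx
  have hxm : ∀ k, Measurable (x k) := fun k => (measurable_bilin (M k).1).const_mul l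
  have hcx : ∀ k : ℕ, ENNReal.ofReal (Real.exp (2 * (l * c))) ≤
      ∫⁻ q, ENNReal.ofReal (Real.exp (2 * |x k q|)) ∂(pairLaw P p₁ p₂) := by
    intro k
    by_cases htop : ∫⁻ q, ENNReal.ofReal (Real.exp (2 * |x k q|)) ∂(pairLaw P p₁ p₂) = ∞
    · rw [htop]; exact le_top
    have hxk := hxm k
    have hexp : Integrable (fun q => Real.exp (2 * |x k q|)) (pairLaw P p₁ p₂) := by
      refine ⟨by fun_prop, ?_⟩
      rw [hasFiniteIntegral_iff_ofReal (Filter.Eventually.of_forall fun q => (Real.exp_pos _).le)]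
      exact lt_top_iff_ne_top.mpr htop
    rw [← ofReal_integral_eq_lintegral_ofReal hexp
      (Filter.Eventually.of_forall fun q => (Real.exp_pos _).le)]
    apply ENNReal.ofReal_le_ofReal
    have h1 := h.le_integral_abs_bilin hs.integral_id hL hv (M k).2.1
    have hint : Integrable (fun q => 2 * |x k q|) (pairLaw P p₁ p₂) := by
      refine Integrable.const_mul (Integrable.abs (Integrable.const_mul ?_ l)) 2
      exact (integrable_of_lintegral_pow_four_lt_top (measurable_bilin (M k).1)
        ((h.lintegral_bilin_pow_four_le (M k).1).trans_lt ofReal_lt_top)).1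
    have h2 := convexOn_exp.map_integral_le Real.continuous_exp.continuousOn isClosed_univ
      (Filter.Eventually.of_forall fun _ => Set.mem_univ _) hint hexp
    refine le_trans (Real.exp_le_exp.mpr ?_) h2
    rw [integral_const_mul]
    simp only [hx, abs_mul, abs_of_nonneg hl]
    rw [integral_const_mul]
    have := hc.trans h1
    gcongr
  have hcomp := lintegral_iSup_prod_le (Q := pairLaw P p₁ p₂)
    (φ := fun k q => ENNReal.ofReal (Real.exp (l * c - |x k q|)))
    (ψ := fun k q => ENNReal.ofReal (Real.exp (2 * x k q)))
    (fun k => by have := hxm k; fun_prop) (fun k => by have := hxm k; fun_prop)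
    (lintegral_iSup_exp_sub_abs_le hxm hs.measurePreserving_neg_pairLaw
      (fun k q => by simp [hx]) hcx) n (fun _ => 1)
  simp only [one_mul] at hcomp
  have hrhs : ∫⁻ d, ⨆ k, ∏ i, ENNReal.ofReal (Real.exp (2 * x k (d i)))
      ∂(designLaw P p₁ p₂ n) ≤
      ENNReal.ofReal (Real.exp (11 / 5 * (p₁ + p₂) + 16 / 5 * (8 * l * √r) ^ 2 * a ^ 4 * n)) := by
    have h1 := h.lintegral_exp_specNorm_le (p₁ := p₁) (p₂ := p₂) (n := n) (w := fun _ => 1)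
      (l := 8 * l * √r) (by positivity) (fun _ => by rw [abs_one]; linarith)
    simp only [one_pow, Finset.sum_const, Finset.card_univ, Fintype.card_fin, nsmul_eq_mul,
      mul_one] at h1
    refine le_trans (lintegral_mono fun d => iSup_le fun k => ?_) h1
    rw [← ENNReal.ofReal_prod_of_nonneg fun _ _ => (Real.exp_pos _).le, ← Real.exp_sum]
    apply ENNReal.ofReal_le_ofReal
    rw [Real.exp_le_exp]
    have h2 : ∑ i, 2 * x k (d i) =
        2 * l * frobInner (dual (fun i => (d i).1) (fun i => (d i).2) fun _ => 1) (M k).1 := by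
      rw [frobInner_dual, Finset.mul_sum]
      simp [hx, ropMap, mul_assoc]
    rw [h2]
    calc _ ≤ 2 * l * (specNorm (dual (fun i => (d i).1) (fun i => (d i).2) fun _ => 1) *
          (4 * √r)) := by
          gcongr
          exact (frobInner_le _ _).trans (mul_le_mul_of_nonneg_left (M k).2.2 (specNorm_nonneg _))
      _ = _ := by ring
  have hsub : {d : Fin n → (Fin p₁ → ℝ) × (Fin p₂ → ℝ) |
      ¬ConeBound (c / 2) r (fun i => (d i).1) (fun i => (d i).2)} ⊆
      {d | ENNReal.ofReal (Real.exp (l * (c / 2 * n))) ≤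
        ⨆ k, ∏ i, ENNReal.ofReal (Real.exp (l * c - |x k (d i)|))} := by
    intro d hd
    obtain ⟨N, hN, hlt⟩ := exists_coneSphere_of_not_coneBound hd
    have hopen : IsOpen {N : coneSphere p₁ p₂ r |
        ∑ i, |ropMap (fun i => (d i).1) (fun i => (d i).2) N.1 i| < c / 2 * n} := by
      refine isOpen_lt ?_ continuous_const
      have := (continuous_ropMap (fun i => (d i).1) (fun i => (d i).2)).comp
        (continuous_subtype_val (p := (· ∈ coneSphere p₁ p₂ r)))
      exact continuous_finsetSum _ fun i _ => ((continuous_apply i).comp this).abs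
    obtain ⟨_, hk, k, rfl⟩ := (TopologicalSpace.denseRange_denseSeq
      (coneSphere p₁ p₂ r)).inter_open_nonempty _ hopen ⟨⟨N, hN⟩, hlt⟩
    refine le_trans ?_ (le_iSup
      (fun k => ∏ i, ENNReal.ofReal (Real.exp (l * c - |x k (d i)|))) k)
    rw [← ENNReal.ofReal_prod_of_nonneg fun _ _ => (Real.exp_pos _).le, ← Real.exp_sum]
    apply ENNReal.ofReal_le_ofReal
    rw [Real.exp_le_exp]
    have h3 : ∑ i, (l * c - |x k (d i)|) =
        l * (c * n - ∑ i, |ropMap (fun i => (d i).1) (fun i => (d i).2) (M k).1 i|) := by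
      rw [Finset.sum_sub_distrib, mul_sub, Finset.mul_sum]
      simp [hx, ropMap, abs_mul, abs_of_nonneg hl]
      ring
    rw [h3]
    refine mul_le_mul_of_nonneg_left ?_ hl
    have hk' : ∑ i, |ropMap (fun i => (d i).1) (fun i => (d i).2) (M k).1 i| < c / 2 * n := hk
    linarith
  have hmeas : Measurable fun d : Fin n → (Fin p₁ → ℝ) × (Fin p₂ → ℝ) =>
      ⨆ k, ∏ i, ENNReal.ofReal (Real.exp (l * c - |x k (d i)|)) := by fun_prop
  have hmarkov := (mul_meas_ge_le_lintegral (μ := designLaw P p₁ p₂ n) hmeas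
    (ENNReal.ofReal (Real.exp (l * (c / 2 * n))))).trans (hcomp.trans hrhs)
  rw [Real.exp_sub, ENNReal.ofReal_div_of_pos (Real.exp_pos _),
    ENNReal.le_div_iff_mul_le (Or.inl (by simp [Real.exp_pos])) (Or.inl ofReal_ne_top), mul_comm]
  refine le_trans ?_ hmarkov
  gcongr

/-- The lower bound constant of the design. -/
noncomputable def lowerConst (a : ℝ) : ℝ := 3 / (8 * momentConst a)

lemma lowerConst_pos (a : ℝ) : 0 < lowerConst a := by
  have := momentConst_pos a
  unfold lowerConst; positivity

lemma lowerConst_le_one (a : ℝ) : lowerConst a ≤ 1 := by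
  have h1 : 1 ≤ Real.exp (a ^ 2 / 2) := Real.one_le_exp (by positivity)
  rw [lowerConst, momentConst, div_le_one (by positivity)]
  linarith

/-- With high probability the design is bounded below on the cone. -/
theorem MGFBound.designLaw_not_coneBound_le (h : MGFBound P a) (ha : 1 ≤ a) (hs : IsSymmetric P)
    (hL : MemLp id 2 P) (hv : Var[id; P] = 1) (hr : 0 < r)
    (hn : 11000 * a ^ 4 / lowerConst a ^ 2 * r * (p₁ + p₂) ≤ n) :
    designLaw P p₁ p₂ n
        {d | ¬ConeBound (lowerConst a / 2) r (fun i => (d i).1) (fun i => (d i).2)} ≤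
      ENNReal.ofReal (Real.exp (-(p₁ + p₂))) := by
  have hc0 := lowerConst_pos a
  have hc1 := lowerConst_le_one a
  have hr' : (1 : ℝ) ≤ r := by exact_mod_cast hr
  have ha0 : 0 < a := by linarith
  set c := lowerConst a with hcdef
  set l := c / (1000 * r * a ^ 4) with hl
  have hsr := Real.sq_sqrt (Nat.cast_nonneg (α := ℝ) r)
  have hsr1 : 1 ≤ √(r : ℝ) := Real.one_le_sqrt.mpr hr'
  refine (h.designLaw_not_coneBound_le_exp hs hL hv (l := l) (by positivity) hcdef.le ?_).trans ?_
  · have h1 : 16 * l * √r * a ^ 2 = 2 / 125 * (c / (√r * a ^ 2)) := by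
      have hl' : l = c / (1000 * √r ^ 2 * a ^ 4) := by rw [hsr]
      rw [hl']
      field_simp
      ring
    rw [h1]
    have h2 : c / (√r * a ^ 2) ≤ 1 := by
      rw [div_le_one (by positivity)]
      have h3 : 1 ≤ √(r : ℝ) * a ^ 2 := one_le_mul_of_one_le_of_one_le hsr1 (one_le_pow₀ ha)
      linarith
    linarith
  · apply ENNReal.ofReal_le_ofReal
    rw [Real.exp_le_exp]
    have h1 : 16 / 5 * (8 * l * √r) ^ 2 * a ^ 4 * n - l * (c / 2 * n) =
        -(2952 / 10000000) * (c ^ 2 * n / (r * a ^ 4)) := by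
      rw [mul_pow, mul_pow, hsr, hl]
      field_simp
      ring
    have h2 : 11000 * (p₁ + p₂) ≤ c ^ 2 * n / (r * a ^ 4) := by
      rw [le_div_iff₀ (by positivity)]
      calc 11000 * (p₁ + p₂ : ℝ) * (r * a ^ 4)
          = c ^ 2 * (11000 * a ^ 4 / c ^ 2 * r * (p₁ + p₂)) := by field_simp
        _ ≤ c ^ 2 * n := by gcongr
    have h3 : (0 : ℝ) ≤ p₁ + p₂ := by positivity
    linarith

lemma exists_chernoff_parameter {p m M : ℝ} (hp : 0 ≤ p) (hm : 0 < m) (hM : 0 ≤ M) :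
    ∃ θ : ℝ, 0 ≤ θ ∧ θ * M ≤ 4 / 5 ∧
      12 / 5 * p + 24 / 5 * θ ^ 2 * m ≤ 3 * θ * (√(6 * m * p) + M * p) := by
  have h6 : (61 / 25 : ℝ) ≤ √6 := by
    apply Real.le_sqrt_of_sq_le; norm_num
  have hsqrt : √(6 * m * p) = √6 * √(m * p) := by
    rw [mul_assoc, Real.sqrt_mul (by norm_num)]
  have hs2 : √(m * p) ^ 2 = m * p := Real.sq_sqrt (by positivity)
  set s := √(m * p)
  have hs : 0 ≤ s := Real.sqrt_nonneg _
  rw [hsqrt]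
  rcases le_or_gt (3 / 4 * (s / m) * M) (4 / 5) with hcase | hcase
  · refine ⟨3 / 4 * (s / m), by positivity, hcase, ?_⟩
    have e1 : 24 / 5 * (3 / 4 * (s / m)) ^ 2 * m = 27 / 10 * p := by
      rw [mul_pow, div_pow s, hs2]
      field_simp
      ring
    have e2 : 3 * (3 / 4 * (s / m)) * (√6 * s + M * p) =
        9 / 4 * √6 * p + 9 / 4 * (s / m) * (M * p) := by
      have : s / m * s = p := by
        rw [div_mul_eq_mul_div, ← sq, hs2]
        field_simp
      calc _ = 9 / 4 * √6 * (s / m * s) + 9 / 4 * (s / m) * (M * p) := by ring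
        _ = _ := by rw [this]
    rw [e1, e2]
    have e3 : 0 ≤ 9 / 4 * (s / m) * (M * p) := by positivity
    nlinarith
  · have hMpos : 0 < M := by
      rcases hM.eq_or_lt with h0 | h0
      · rw [← h0, mul_zero] at hcase
        norm_num at hcase
      · exact h0
    have hθM : 4 / 5 / M * M = 4 / 5 := by field_simp
    refine ⟨4 / 5 / M, by positivity, hθM.le, ?_⟩
    set θ := 4 / 5 / M
    have hθ : 0 ≤ θ := by positivity
    have e1 : θ ≤ 3 / 4 * (s / m) := by
      rw [div_le_iff₀ hMpos]
      exact hcase.le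
    have e2 : θ * m ≤ 3 / 4 * s := by
      calc θ * m ≤ 3 / 4 * (s / m) * m := by gcongr
        _ = 3 / 4 * s := by field_simp
    have e3 : 24 / 5 * θ ^ 2 * m ≤ 18 / 5 * θ * s := by nlinarith
    have e4 : 3 * θ * (√6 * s + M * p) = 3 * θ * √6 * s + 12 / 5 * p := by
      calc _ = 3 * θ * √6 * s + 3 * (θ * M) * p := by ring
        _ = _ := by rw [hθM]; ring
    have e5 : θ * s * (61 / 25) ≤ θ * s * √6 := by gcongr
    have e6 : 0 ≤ θ * s := by positivity
    rw [e4]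
    nlinarith

/-- For a fixed noise vector of controlled size, the spectral norm constraint holds with high
probability. -/
theorem designLaw_specRadius_le (h : MGFBound P (alpha P)) (ha : 1 ≤ alpha P) {τ : ℝ} (hτ : 0 < τ)
    (hn : 0 < n) {w : Fin n → ℝ} (hw : ∀ i, |w i| ≤ 2 * √(Real.log n) * τ)
    (hw2 : ∑ i, w i ^ 2 ≤ 6 * n * τ ^ 2) :
    designLaw P p₁ p₂ n {d | specRadius P τ p₁ p₂ n ≤
        specNorm (dual (fun i => (d i).1) (fun i => (d i).2) w)} ≤
      ENNReal.ofReal (Real.exp (-(1 / 5) * (p₁ + p₂))) := by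
  have hn' : (0 : ℝ) < n := by exact_mod_cast hn
  have ha0 : 0 < alpha P := by linarith
  obtain ⟨θ, hθ, hθM, hθe⟩ := exists_chernoff_parameter (p := p₁ + p₂) (m := n)
    (M := 2 * √(Real.log n)) (by positivity) hn' (by positivity)
  set a := alpha P with hadef
  refine (h.designLaw_specNorm_ge_le (l := θ / (2 * a ^ 2 * τ)) (by positivity)
    fun i => ?_).trans ?_
  · calc 2 * (θ / (2 * a ^ 2 * τ)) * |w i| * a ^ 2 = θ / τ * |w i| := by field_simp
      _ ≤ θ / τ * (2 * √(Real.log n) * τ) := by gcongr; exact hw i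
      _ = θ * (2 * √(Real.log n)) := by field_simp
      _ ≤ 4 / 5 := hθM
  · apply ENNReal.ofReal_le_ofReal
    rw [Real.exp_le_exp]
    have e1 : 16 / 5 * (θ / (2 * a ^ 2 * τ)) ^ 2 * a ^ 4 * ∑ i, w i ^ 2 ≤ 24 / 5 * θ ^ 2 * n := by
      calc _ ≤ 16 / 5 * (θ / (2 * a ^ 2 * τ)) ^ 2 * a ^ 4 * (6 * n * τ ^ 2) := by gcongr
        _ = _ := by field_simp; ring
    have e2 : θ / (2 * a ^ 2 * τ) * specRadius P τ p₁ p₂ n =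
        3 * θ * (√(6 * n * (p₁ + p₂)) + 2 * √(Real.log n) * (p₁ + p₂)) := by
      rw [specRadius, ← hadef]
      field_simp
      ring
    rw [e2]
    linarith

end DesignBounds

section NoiseBounds

open ENNReal

variable {ν : Measure ℝ} [IsProbabilityMeasure ν] {τ : ℝ} {n : ℕ}

/-- The coordinates of the noise are uniformly bounded with high probability. -/
lemma IsSubGaussian.pi_exists_abs_ge_le (h : IsSubGaussian ν τ) (hτ : 0 < τ) (hn : 2 ≤ n) :
    (Measure.pi fun _ : Fin n => ν) {z | ∃ i, 2 * √(Real.log n) * τ ≤ |z i|} ≤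
      ENNReal.ofReal (2 / n) := by
  have hn' : (2 : ℝ) ≤ n := by exact_mod_cast hn
  have hlog : 0 < Real.log n := Real.log_pos (by linarith)
  have h1 := h (2 * √(Real.log n) * τ) (by positivity)
  have h2 : -(2 * √(Real.log n) * τ) ^ 2 / (2 * τ ^ 2) = -(2 * Real.log n) := by
    rw [mul_pow, mul_pow, Real.sq_sqrt hlog.le]
    field_simp
  have h3 : Real.exp (-(2 * Real.log n)) = ((n : ℝ) ^ 2)⁻¹ := by
    rw [Real.exp_neg, mul_comm, Real.exp_mul, Real.exp_log (by linarith)]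
    norm_num
  rw [h2, h3] at h1
  have hms : MeasurableSet {x : ℝ | 2 * √(Real.log n) * τ ≤ |x|} :=
    measurableSet_le measurable_const (by fun_prop)
  calc _ ≤ ∑ i : Fin n, (Measure.pi fun _ : Fin n => ν) {z | 2 * √(Real.log n) * τ ≤ |z i|} := by
        rw [show {z : Fin n → ℝ | ∃ i, 2 * √(Real.log n) * τ ≤ |z i|} =
          ⋃ i, {z | 2 * √(Real.log n) * τ ≤ |z i|} by ext; simp]
        exact measure_iUnion_fintype_le _ _
    _ ≤ ∑ i : Fin n, ENNReal.ofReal (2 * ((n : ℝ) ^ 2)⁻¹) := by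
        refine Finset.sum_le_sum fun i _ => ?_
        have h4 := (measurePreserving_eval (fun _ : Fin n => ν) i).measure_preimage
          hms.nullMeasurableSet
        have h5 : Function.eval i ⁻¹' {x : ℝ | 2 * √(Real.log n) * τ ≤ |x|} =
          {z : Fin n → ℝ | 2 * √(Real.log n) * τ ≤ |z i|} := rfl
        rw [← h5, h4, ← ofReal_measureReal]
        exact ENNReal.ofReal_le_ofReal h1
    _ = ENNReal.ofReal (2 / n) := by
        rw [Finset.sum_const, Finset.card_univ, Fintype.card_fin, nsmul_eq_mul,
          ← ENNReal.ofReal_natCast, ← ENNReal.ofReal_mul (by positivity)]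
        congr 1
        field_simp

/-- The Euclidean norm of the noise is of the expected order with high probability. -/
lemma IsSubGaussian.pi_sum_sq_ge_le (h : IsSubGaussian ν τ) (hτ : 0 < τ) (n : ℕ) :
    (Measure.pi fun _ : Fin n => ν) {z | 6 * n * τ ^ 2 ≤ ∑ i, z i ^ 2} ≤
      ENNReal.ofReal (Real.exp (-(1 / 5) * n)) := by
  set l := 1 / (8 * τ ^ 2) with hl
  have h1 : ∫⁻ x, ENNReal.ofReal (Real.exp (l * x ^ 2)) ∂ν ≤
      ENNReal.ofReal (Real.exp (11 / 20)) := by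
    refine (h.lintegral_exp_sq_le hτ (by positivity) ?_).trans (ENNReal.ofReal_le_ofReal ?_)
    · rw [hl]; field_simp; norm_num
    · have h2 : 1 + 4 * l * τ ^ 2 / (1 - 2 * l * τ ^ 2) = 5 / 3 := by
        have : l * τ ^ 2 = 1 / 8 := by rw [hl]; field_simp
        rw [mul_assoc, mul_assoc, this]; norm_num
      rw [h2]
      have := Real.quadratic_le_exp_of_nonneg (show (0 : ℝ) ≤ 11 / 20 by norm_num)
      linarith
  have h3 : ∀ z : Fin n → ℝ, ENNReal.ofReal (Real.exp (l * ∑ i, z i ^ 2)) =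
      ∏ i, ENNReal.ofReal (Real.exp (l * z i ^ 2)) := fun z => by
    rw [Finset.mul_sum, Real.exp_sum,
      ENNReal.ofReal_prod_of_nonneg fun _ _ => (Real.exp_pos _).le]
  have h4 : ∫⁻ z, ENNReal.ofReal (Real.exp (l * ∑ i, z i ^ 2)) ∂(Measure.pi fun _ : Fin n => ν) ≤
      ENNReal.ofReal (Real.exp (11 / 20 * n)) := by
    rw [lintegral_congr h3, lintegral_pi_prod (fun _ => ν)
      (f := fun _ x => ENNReal.ofReal (Real.exp (l * x ^ 2))) (fun i => by fun_prop)]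
    refine (Finset.prod_le_prod' fun i _ => h1).trans_eq ?_
    rw [Finset.prod_const, Finset.card_univ, Fintype.card_fin,
      ← ENNReal.ofReal_pow (Real.exp_pos _).le, ← Real.exp_nat_mul, mul_comm]
  have hm : Measurable fun z : Fin n → ℝ => ENNReal.ofReal (Real.exp (l * ∑ i, z i ^ 2)) := by
    fun_prop
  have h5 := (mul_meas_ge_le_lintegral (μ := Measure.pi fun _ : Fin n => ν) hm
    (ENNReal.ofReal (Real.exp (l * (6 * n * τ ^ 2))))).trans h4
  have h6 : -(1 / 5 : ℝ) * n = 11 / 20 * n - l * (6 * n * τ ^ 2) := by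
    rw [hl]; field_simp; norm_num; ring
  rw [h6, Real.exp_sub, ENNReal.ofReal_div_of_pos (Real.exp_pos _),
    ENNReal.le_div_iff_mul_le (Or.inl (by simp [Real.exp_pos])) (Or.inl ofReal_ne_top), mul_comm]
  refine le_trans ?_ h5
  gcongr with z
  intro hz
  exact ENNReal.ofReal_le_ofReal (Real.exp_le_exp.mpr
    (mul_le_mul_of_nonneg_left hz (by positivity)))

end NoiseBounds

section Law

variable {P : Measure ℝ} [IsProbabilityMeasure P] {p₁ p₂ n : ℕ}

/-- All entries of a design, as one family. -/
def flattenDesign (d : Fin n → (Fin p₁ → ℝ) × (Fin p₂ → ℝ)) :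
    (Fin n × Fin p₁) ⊕ (Fin n × Fin p₂) → ℝ :=
  Sum.elim (fun a => (d a.1).1 a.2) fun b => (d b.1).2 b.2

/-- The design with given entries. -/
def unflattenDesign (f : (Fin n × Fin p₁) ⊕ (Fin n × Fin p₂) → ℝ) :
    Fin n → (Fin p₁ → ℝ) × (Fin p₂ → ℝ) :=
  fun i => (fun j => f (Sum.inl (i, j)), fun k => f (Sum.inr (i, k)))

lemma measurable_flattenDesign :
    Measurable (flattenDesign : (Fin n → (Fin p₁ → ℝ) × (Fin p₂ → ℝ)) → _) := by
  refine measurable_pi_iff.mpr ?_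
  rintro (a | b)
  · exact (measurable_pi_apply a.2).comp (measurable_fst.comp (measurable_pi_apply a.1))
  · exact (measurable_pi_apply b.2).comp (measurable_snd.comp (measurable_pi_apply b.1))

lemma measurable_unflattenDesign :
    Measurable (unflattenDesign : _ → Fin n → (Fin p₁ → ℝ) × (Fin p₂ → ℝ)) := by
  unfold unflattenDesign
  fun_prop

lemma map_flattenDesign : (designLaw P p₁ p₂ n).map flattenDesign = Measure.pi fun _ => P := by
  refine (Measure.pi_eq fun s hs => ?_).symm
  rw [Measure.map_apply measurable_flattenDesign (MeasurableSet.univ_pi hs)]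
  have : flattenDesign ⁻¹' Set.univ.pi s = Set.univ.pi fun i : Fin n =>
      (Set.univ.pi fun j : Fin p₁ => s (Sum.inl (i, j))) ×ˢ
        (Set.univ.pi fun k : Fin p₂ => s (Sum.inr (i, k))) := by
    ext d
    simp only [Set.mem_preimage, Set.mem_pi, Set.mem_univ, true_implies, Set.mem_prod, Sum.forall,
      Prod.forall, flattenDesign, Sum.elim_inl, Sum.elim_inr, forall_and]
  rw [this, Measure.pi_pi]
  simp only [Measure.prod_prod, Measure.pi_pi, Fintype.prod_sum_type, Fintype.prod_prod_type,
    Finset.prod_mul_distrib]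

lemma IsROP.map_design {Ω : Type*} [MeasurableSpace Ω] {μ : Measure Ω} [IsProbabilityMeasure μ]
    {β : Fin n → Fin p₁ → Ω → ℝ} {γ : Fin n → Fin p₂ → Ω → ℝ} (h : IsROP μ P β γ) :
    μ.map (fun ω i => ((fun j => β i j ω, fun k => γ i k ω) : (Fin p₁ → ℝ) × (Fin p₂ → ℝ))) =
      designLaw P p₁ p₂ n := by
  have hlaw : ∀ x, HasLaw (Sum.elim (fun a : Fin n × Fin p₁ => β a.1 a.2)
      (fun b : Fin n × Fin p₂ => γ b.1 b.2) x) P μ := by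
    rintro (a | b)
    exacts [h.law_left _ _, h.law_right _ _]
  have h1 := (iIndepFun_iff_map_fun_eq_pi_map fun x => (hlaw x).aemeasurable).mp h.indep
  simp only [(hlaw _).map_eq] at h1
  have hae : AEMeasurable (fun ω x => (Sum.elim (fun a : Fin n × Fin p₁ => β a.1 a.2)
      (fun b : Fin n × Fin p₂ => γ b.1 b.2) x : Ω → ℝ) ω) μ :=
    aemeasurable_pi_lambda _ fun x => (hlaw x).aemeasurable
  have h2 : (fun ω i => ((fun j => β i j ω, fun k => γ i k ω) : (Fin p₁ → ℝ) × (Fin p₂ → ℝ))) =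
      unflattenDesign ∘ fun ω x => (Sum.elim (fun a : Fin n × Fin p₁ => β a.1 a.2)
      (fun b : Fin n × Fin p₂ => γ b.1 b.2) x : Ω → ℝ) ω := rfl
  rw [h2, ← AEMeasurable.map_map_of_aemeasurable measurable_unflattenDesign.aemeasurable hae, h1,
    ← map_flattenDesign (P := P),
    Measure.map_map measurable_unflattenDesign measurable_flattenDesign]
  exact Measure.map_id

end Law

section BadEvent

variable {P : Measure ℝ} [IsProbabilityMeasure P] {p₁ p₂ n r : ℕ}

/-- The joint law of design and noise. -/
noncomputable abbrev jointLaw (P ν : Measure ℝ) (p₁ p₂ n : ℕ) :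
    Measure ((Fin n → (Fin p₁ → ℝ) × (Fin p₂ → ℝ)) × (Fin n → ℝ)) :=
  (designLaw P p₁ p₂ n).prod (Measure.pi fun _ => ν)

/-- Noise vectors of controlled size. -/
def goodNoise (τ : ℝ) (n : ℕ) : Set (Fin n → ℝ) :=
  {z | (∀ i, |z i| < 2 * √(Real.log n) * τ) ∧ ∑ i, z i ^ 2 < 6 * n * τ ^ 2}

lemma measurableSet_goodNoise (τ : ℝ) (n : ℕ) : MeasurableSet (goodNoise τ n) := by
  have h2 : MeasurableSet {z : Fin n → ℝ | ∑ i, z i ^ 2 < 6 * n * τ ^ 2} :=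
    measurableSet_lt (by fun_prop) measurable_const
  have h1 : {z : Fin n → ℝ | ∀ i, |z i| < 2 * √(Real.log n) * τ} =
      ⋂ i, {z | |z i| < 2 * √(Real.log n) * τ} := by ext; simp
  have h3 : MeasurableSet {z : Fin n → ℝ | ∀ i, |z i| < 2 * √(Real.log n) * τ} :=
    h1 ▸ MeasurableSet.iInter fun i => measurableSet_lt (by fun_prop) measurable_const
  exact h3.inter h2

lemma sum_abs_div_le_of_mem_goodNoise {τ : ℝ} (hτ : 0 < τ) (hn : 0 < n) {z : Fin n → ℝ}
    (hz : z ∈ goodNoise τ n) : (∑ i, |z i|) / n ≤ 6 * τ := by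
  have hn' : (0 : ℝ) < n := by exact_mod_cast hn
  rw [div_le_iff₀ hn']
  refine abs_le_of_sq_le_sq' ?_ (by positivity) |>.2
  calc (∑ i, |z i|) ^ 2 ≤ n * ∑ i, |z i| ^ 2 := by
        simpa using sq_sum_le_card_mul_sum_sq (s := Finset.univ) (f := fun i => |z i|)
    _ = n * ∑ i, z i ^ 2 := by simp only [sq_abs]
    _ ≤ n * (6 * n * τ ^ 2) := by gcongr; exact hz.2.le
    _ ≤ (6 * τ * n) ^ 2 := by nlinarith [sq_nonneg (τ * n)]

/-- The pairs of design and noise for which the recovery guarantee may fail. -/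
def badSet (P : Measure ℝ) (τ c : ℝ) (p₁ p₂ n r : ℕ) :
    Set ((Fin n → (Fin p₁ → ℝ) × (Fin p₂ → ℝ)) × (Fin n → ℝ)) :=
  {q | ¬ConeBound c r (fun i => (q.1 i).1) (fun i => (q.1 i).2)} ∪
  {q | q.2 ∉ goodNoise τ n} ∪
  {q | q.2 ∈ goodNoise τ n ∧ specRadius P τ p₁ p₂ n ≤
    specNorm (dual (fun i => (q.1 i).1) (fun i => (q.1 i).2) q.2)}

omit [IsProbabilityMeasure P] in
lemma mem_constraintSet_of_notMem_badSet {τ c : ℝ} (hτ : 0 < τ) (hn : 0 < n)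
    {q : (Fin n → (Fin p₁ → ℝ) × (Fin p₂ → ℝ)) × (Fin n → ℝ)}
    (hq : q ∉ badSet P τ c p₁ p₂ n r) :
    ConeBound c r (fun i => (q.1 i).1) (fun i => (q.1 i).2) ∧
      q.2 ∈ constraintSet P τ (fun i => (q.1 i).1) (fun i => (q.1 i).2) := by
  simp only [badSet, Set.mem_union, Set.mem_ofPred_eq, not_or, not_not, not_and, not_le] at hq
  exact ⟨hq.1.1, sum_abs_div_le_of_mem_goodNoise hτ hn hq.1.2, (hq.2 hq.1.2).le⟩

lemma continuous_dual_pair :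
    Continuous fun q : (Fin n → (Fin p₁ → ℝ) × (Fin p₂ → ℝ)) × (Fin n → ℝ) =>
      dual (fun i => (q.1 i).1) (fun i => (q.1 i).2) q.2 := by
  unfold dual Matrix.vecMulVec
  fun_prop

theorem jointLaw_badSet_le {σ : ℝ} (hsymm : IsSymmetric P) (hvar : Var[id; P] = 1) (hσ : 0 < σ)
    (hsub : IsSubGaussian P σ) (hr : 0 < r) (hn2 : 2 ≤ n) (hnp : (p₁ + p₂ : ℝ) ≤ n)
    (hn : 11000 * alpha P ^ 4 / lowerConst (alpha P) ^ 2 * r * (p₁ + p₂) ≤ n)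
    {τ : ℝ} (hτ : 0 < τ) {ν : Measure ℝ} [IsProbabilityMeasure ν] (hν : IsSubGaussian ν τ) :
    jointLaw P ν p₁ p₂ n (badSet P τ (lowerConst (alpha P) / 2) p₁ p₂ n r) ≤
      ENNReal.ofReal (2 / n + 5 * Real.exp (-(1 / 5) * (p₁ + p₂))) := by
  have hmgf : MGFBound P (alpha P) := fun t => hsub.lintegral_exp_le hσ hsymm t
  have h2 := hsymm.integral_sq hvar
  have hL : MemLp id 2 P := by
    refine (memLp_two_iff_integrable_sq measurable_id.aestronglyMeasurable).mpr ?_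
    simpa using hsub.integrable_pow_two_mul hσ 1
  have ha := hsub.one_le_alpha hσ h2
  set e := Real.exp (-(1 / 5) * (p₁ + p₂ : ℝ)) with he
  have he0 : 0 < e := Real.exp_pos _
  have hp : (0 : ℝ) ≤ p₁ + p₂ := by positivity
  have b1 : jointLaw P ν p₁ p₂ n {q | ¬ConeBound (lowerConst (alpha P) / 2) r
      (fun i => (q.1 i).1) (fun i => (q.1 i).2)} ≤ ENNReal.ofReal e := by
    have h1 : {q : (Fin n → (Fin p₁ → ℝ) × (Fin p₂ → ℝ)) × (Fin n → ℝ) |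
        ¬ConeBound (lowerConst (alpha P) / 2) r (fun i => (q.1 i).1) (fun i => (q.1 i).2)} =
        {d | ¬ConeBound (lowerConst (alpha P) / 2) r (fun i => (d i).1) (fun i => (d i).2)} ×ˢ
          Set.univ := by
      ext; simp
    rw [h1, Measure.prod_prod, measure_univ, mul_one]
    refine (hmgf.designLaw_not_coneBound_le ha hsymm hL hvar hr hn).trans ?_
    exact ENNReal.ofReal_le_ofReal (Real.exp_le_exp.mpr (by linarith))
  have b2 : jointLaw P ν p₁ p₂ n {q | q.2 ∉ goodNoise τ n} ≤
      ENNReal.ofReal (2 / n) + ENNReal.ofReal e := by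
    have h1 : {q : (Fin n → (Fin p₁ → ℝ) × (Fin p₂ → ℝ)) × (Fin n → ℝ) | q.2 ∉ goodNoise τ n} =
        Set.univ ×ˢ (goodNoise τ n)ᶜ := by
      ext; simp
    have h3 : (goodNoise τ n)ᶜ = {z | ∃ i, 2 * √(Real.log n) * τ ≤ |z i|} ∪
        {z | 6 * n * τ ^ 2 ≤ ∑ i, z i ^ 2} := by
      ext z
      simp only [goodNoise, Set.mem_compl_iff, Set.mem_ofPred_eq, Set.mem_union, not_and_or,
        not_forall, not_lt]
    rw [h1, Measure.prod_prod, measure_univ, one_mul, h3]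
    refine (measure_union_le _ _).trans (add_le_add (hν.pi_exists_abs_ge_le hτ hn2)
      ((hν.pi_sum_sq_ge_le hτ n).trans ?_))
    exact ENNReal.ofReal_le_ofReal (Real.exp_le_exp.mpr (by linarith))
  have b3 : jointLaw P ν p₁ p₂ n {q | q.2 ∈ goodNoise τ n ∧ specRadius P τ p₁ p₂ n ≤
      specNorm (dual (fun i => (q.1 i).1) (fun i => (q.1 i).2) q.2)} ≤ ENNReal.ofReal e := by
    have hms : MeasurableSet {q : (Fin n → (Fin p₁ → ℝ) × (Fin p₂ → ℝ)) × (Fin n → ℝ) |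
        q.2 ∈ goodNoise τ n ∧ specRadius P τ p₁ p₂ n ≤
          specNorm (dual (fun i => (q.1 i).1) (fun i => (q.1 i).2) q.2)} :=
      (measurable_snd (measurableSet_goodNoise τ n)).inter (measurableSet_le measurable_const
        (continuous_specNorm.comp continuous_dual_pair).measurable)
    rw [Measure.prod_apply_symm hms]
    calc _ ≤ ∫⁻ _, ENNReal.ofReal e ∂(Measure.pi fun _ : Fin n => ν) := by
          refine lintegral_mono fun z => ?_
          by_cases hz : z ∈ goodNoise τ n
          · refine le_trans (measure_mono ?_) (designLaw_specRadius_le hmgf ha hτ (by omega)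
              (fun i => (hz.1 i).le) hz.2.le)
            exact fun d hd => hd.2
          · refine le_trans (le_of_eq ?_) zero_le
            rw [← measure_empty (μ := designLaw P p₁ p₂ n)]
            congr 1
            ext d
            simp [hz]
      _ = _ := by simp
  have hn0 : (0 : ℝ) ≤ 2 / n := by positivity
  calc _ ≤ ENNReal.ofReal e + (ENNReal.ofReal (2 / n) + ENNReal.ofReal e) + ENNReal.ofReal e :=
        (measure_union_le _ _).trans (add_le_add ((measure_union_le _ _).trans
          (add_le_add b1 b2)) b3)
    _ = ENNReal.ofReal (e + (2 / n + e) + e) := by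
        rw [ENNReal.ofReal_add (by positivity) he0.le, ENNReal.ofReal_add he0.le (by positivity),
          ENNReal.ofReal_add hn0 he0.le]
    _ ≤ _ := ENNReal.ofReal_le_ofReal (by linarith)

end BadEvent

end ROP

open ROP

theorem theorem3p1 (P : Measure ℝ) [IsProbabilityMeasure P] (hsymm : ROP.IsSymmetric P)
    (hvar : Var[id; P] = 1) (hsub : ∃ σ : ℝ, 0 < σ ∧ ROP.IsSubGaussian P σ) :
    ∃ C W₁ W₂ δ : ℝ, 0 < C ∧ 0 < W₁ ∧ 0 < W₂ ∧ 0 < δ ∧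
      ∀ (p₁ p₂ n r : ℕ), 0 < p₁ → 0 < p₂ → 0 < r →
      C * r * (p₁ + p₂) ≤ n →
      ∀ (τ : ℝ), 0 < τ →
      ∀ (ν : Measure ℝ) [IsProbabilityMeasure ν], ROP.IsSubGaussian ν τ →
      ∀ (Ω : Type*) [MeasurableSpace Ω] (μ : Measure Ω) [IsProbabilityMeasure μ]
        (β : Fin n → Fin p₁ → Ω → ℝ) (γ : Fin n → Fin p₂ → Ω → ℝ) (z : Fin n → Ω → ℝ),
      ROP.IsROP μ P β γ →
      (∀ i, HasLaw (z i) ν μ) → iIndepFun z μ →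
      IndepFun (fun ω => ((fun i j => β i j ω), (fun i k => γ i k ω))) (fun ω i => z i ω) μ →
      ∃ E : Set Ω, MeasurableSet E ∧
        1 - 2 / (n : ℝ) - 5 * Real.exp (-δ * (p₁ + p₂)) ≤ μ.real E ∧
        ∀ ω ∈ E, ∀ A : Matrix (Fin p₁) (Fin p₂) ℝ,
          let β' : Fin n → Fin p₁ → ℝ := fun i j => β i j ω
          let γ' : Fin n → Fin p₂ → ℝ := fun i k => γ i k ω
          let y : Fin n → ℝ := fun i => ROP.ropMap β' γ' A i + z i ω
          (∃ Ahat, ROP.IsEstimator P τ β' γ' y Ahat) ∧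
          ∀ Ahat, ROP.IsEstimator P τ β' γ' y Ahat →
            ROP.frobSq (Ahat - A) ≤
              W₁ * τ ^ 2 *
                  min (r * Real.log n * (p₁ + p₂) ^ 2 / n ^ 2 + r * (p₁ + p₂) / n) 1 +
                W₂ * (ROP.nuclearNorm (ROP.minusMaxPart r A) ^ 2 / r) := by
  obtain ⟨σ, hσ, hsubσ⟩ := hsub
  have ha : 1 ≤ alpha P := hsubσ.one_le_alpha hσ (hsymm.integral_sq hvar)
  have hl0 := lowerConst_pos (alpha P)
  have hl1 := lowerConst_le_one (alpha P)
  set c := lowerConst (alpha P) / 2 with hc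
  have hc0 : 0 < c := by positivity
  have hC1 : 1 ≤ 11000 * alpha P ^ 4 / lowerConst (alpha P) ^ 2 := by
    rw [one_le_div (by positivity)]
    have e1 : lowerConst (alpha P) ^ 2 ≤ 1 := pow_le_one₀ hl0.le hl1
    have e2 : 1 ≤ alpha P ^ 4 := one_le_pow₀ ha
    linarith
  refine ⟨11000 * alpha P ^ 4 / lowerConst (alpha P) ^ 2,
    144 / c ^ 2 + 64 / c ^ 4 * (432 * alpha P ^ 4), 4, 1 / 5, by linarith, by positivity,
    by norm_num, by norm_num, ?_⟩
  intro p₁ p₂ n r hp₁ hp₂ hr hn τ hτ ν _ hν Ω _ μ _ β γ z hROP hz hzind hind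
  have hr1 : (1 : ℝ) ≤ r := by exact_mod_cast hr
  have hnp : (p₁ + p₂ : ℝ) ≤ n := by
    refine le_trans (le_mul_of_one_le_left (by positivity) ?_) hn
    exact one_le_mul_of_one_le_of_one_le hC1 hr1
  have hn2 : 2 ≤ n := by
    have h1 : p₁ + p₂ ≤ n := by exact_mod_cast hnp
    omega
  let D : Ω → Fin n → (Fin p₁ → ℝ) × (Fin p₂ → ℝ) :=
    fun ω i => (fun j => β i j ω, fun k => γ i k ω)
  let X : Ω → (Fin n → (Fin p₁ → ℝ) × (Fin p₂ → ℝ)) × (Fin n → ℝ) :=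
    fun ω => (D ω, fun i => z i ω)
  have hDm : AEMeasurable D μ := aemeasurable_pi_lambda _ fun i =>
    (aemeasurable_pi_lambda _ fun j => (hROP.law_left i j).aemeasurable).prodMk
      (aemeasurable_pi_lambda _ fun k => (hROP.law_right i k).aemeasurable)
  have hzm : AEMeasurable (fun ω i => z i ω) μ :=
    aemeasurable_pi_lambda _ fun i => (hz i).aemeasurable
  have hzlaw : μ.map (fun ω i => z i ω) = Measure.pi fun _ => ν := by
    rw [(iIndepFun_iff_map_fun_eq_pi_map fun i => (hz i).aemeasurable).mp hzind]
    simp only [(hz _).map_eq]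
  have hDz : IndepFun D (fun ω i => z i ω) μ :=
    hind.comp (φ := fun q : (Fin n → Fin p₁ → ℝ) × (Fin n → Fin p₂ → ℝ) =>
      fun i => (q.1 i, q.2 i)) (by fun_prop) measurable_id
  have hX : μ.map X = jointLaw P ν p₁ p₂ n := by
    rw [(indepFun_iff_map_prod_eq_prod_map_map hDm hzm).mp hDz, hzlaw, hROP.map_design]
  set B := X ⁻¹' badSet P τ c p₁ p₂ n r with hB
  have hBle : μ B ≤ ENNReal.ofReal (2 / n + 5 * Real.exp (-(1 / 5) * (p₁ + p₂))) := by
    refine (Measure.le_map_apply (hDm.prodMk hzm) _).trans ?_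
    have := jointLaw_badSet_le (p₁ := p₁) (p₂ := p₂) hsymm hvar hσ hsubσ hr hn2 hnp hn hτ hν
    rwa [← hX] at this
  refine ⟨(toMeasurable μ B)ᶜ, (measurableSet_toMeasurable μ B).compl, ?_, ?_⟩
  · rw [probReal_compl_eq_one_sub (measurableSet_toMeasurable μ B)]
    have h1 : μ.real (toMeasurable μ B) ≤ 2 / n + 5 * Real.exp (-(1 / 5) * (p₁ + p₂)) := by
      rw [measureReal_def, measure_toMeasurable]
      exact ENNReal.toReal_le_of_le_ofReal (by positivity) hBle
    linarith
  · intro ω hω A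
    have hωB : X ω ∉ badSet P τ c p₁ p₂ n r := fun h =>
      hω (subset_toMeasurable μ B h)
    obtain ⟨hcone, hcons⟩ := mem_constraintSet_of_notMem_badSet hτ (by omega) hωB
    refine ⟨exists_isEstimator _ _ P τ _ (A := A) ?_, fun Ahat hA => ?_⟩
    · convert! hcons using 1
      ext i
      simp [X]
    · exact frobSq_estimator_sub_le hcone hc0 (by omega) hr hcons A Ahat hA
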